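/- Let $\mathcal G=(V,E,\mathcal B)$ be a Borel graph, that is, $(V,\mathcal B)$ is a standard Borel space and $(V,E)$ is a simple graph whose edge set $E$ is a Borel set of unordered pairs of $V$. Suppose that $\mathcal G$ is of subexponential growth: there is $f:\mathbb N\to\mathbb N$ with $f(n)=o((1+\varepsilon)^n)$ for every $\varepsilon>0$ such that for every $v\in V$ and $r\in\mathbb N$, fewer than $f(r)$ vertices are at graph distance at most $r$ from $v$. Let $\Delta(\mathcal G)\in\mathbb N$ be the maximum degree of $\mathcal G$, and suppose that $\Delta(\mathcal G)\ge 3$ and that $\mathcal G$ does not contain a complete graph on $\Delta(\mathcal G)+1$ vertices. Then the Borel chromatic number $\chi_{\mathcal B}(\mathcal G)$, the least $k\in\mathbb N$ for which there is a proper vertex coloring $c:V\to\{1,\dots,k\}$ all of whose color classes $c^{-1}(\{i\})$ belong to $\mathcal B$, satisfies $\chi_{\mathcal B}(\mathcal G)\le\Delta(\mathcal G)$. -/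

import Mathlib

open scoped Asymptotics

namespace BorelCombinatorics

/-- A graph on a standard Borel space is Borel if its edge set is a Borel set of unordered pairs.
The space `Sym2 V` carries the quotient σ-algebra of the product σ-algebra on `V × V`. -/
def IsBorelGraph {V : Type*} [MeasurableSpace V] (G : SimpleGraph V) : Prop :=
  MeasurableSet G.edgeSet

/-- The maximum degree `Δ(G)` of a graph on a possibly infinite vertex set: the supremum of the
vertex degrees, with value `⊤` if the degrees are not uniformly bounded. -/
noncomputable def maxDegree {V : Type*} (G : SimpleGraph V) : ℕ∞ :=
  ⨆ v : V, (G.neighborSet v).encard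

/-- `c : V → [k]` is a proper vertex colouring with `k` colours with Borel colour classes. -/
def IsBorelColoring {V : Type*} [MeasurableSpace V] (G : SimpleGraph V) {k : ℕ}
    (c : V → Fin k) : Prop :=
  (∀ v w, G.Adj v w → c v ≠ c w) ∧ ∀ i : Fin k, MeasurableSet (c ⁻¹' {i})

/-- The Borel chromatic number: the least `k : ℕ` such that a Borel colouring with `k` colours
exists, with value `⊤` if there is no such `k`. -/
noncomputable def borelChromaticNumber {V : Type*} [MeasurableSpace V] (G : SimpleGraph V) : ℕ∞ :=
  sInf {n : ℕ∞ | ∃ k : ℕ, n = k ∧ ∃ c : V → Fin k, IsBorelColoring G c}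

/-- The vertices of graph distance at most `r` from `v`. -/
def closedBall {V : Type*} (G : SimpleGraph V) (v : V) (r : ℕ) : Set V :=
  {u | G.edist v u ≤ r}

/-- `f : ℕ → ℕ` is subexponential if `f ∈ o((1 + ε)^n)` for every `ε > 0`. -/
def IsSubexponential (f : ℕ → ℕ) : Prop :=
  ∀ ε : ℝ, 0 < ε →
    (fun n : ℕ => (f n : ℝ)) =o[Filter.atTop] (fun n : ℕ => (1 + ε) ^ n)

/-- `f` bounds the growth of `G` if every ball of radius `r` has fewer than `f r` vertices. -/
def BoundsGrowth {V : Type*} (f : ℕ → ℕ) (G : SimpleGraph V) : Prop :=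
  ∀ (v : V) (r : ℕ), (closedBall G v r).encard < (f r : ℕ∞)

/-- `G` is of subexponential growth if some subexponential function bounds its growth. -/
def HasSubexponentialGrowth {V : Type*} (G : SimpleGraph V) : Prop :=
  ∃ f : ℕ → ℕ, IsSubexponential f ∧ BoundsGrowth f G

end BorelCombinatorics

namespace BorelCombinatorics

/-! Write `k` for the maximum degree. Call a finite or infinite set of vertices extendable if every
partial `k`-colouring undefined on it can be extended to it, leaving the other vertices alone. This
property is local, and it lets a Borel argument defer finitely many choices to the end.

Combinatorial half: some radius `R` makes every `R`-ball extendable. A vertex of degree below `k` is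
extendable, and so is an even cycle of full-degree vertices one of which has at most two neighbours
on it (`isExtendable_range_of_periodic`). Adding a vertex adjacent to an extendable set preserves
extendability, so a ball containing any nonempty extendable set is itself extendable. In a ball
without such sets (`IsRigidBall`), the breadth-first layers around the centre look like a tree:
parents are unique, and the neighbours of a vertex in its own layer form, if there are at least two,
a clique with it and its parent. The absence of a `(k + 1)`-clique then gives every vertex off the
centre a child, and two grandchildren, as long as the layers involved stay in the ball. The layers
double every two steps (`IsRigidBall.two_pow_le`), which subexponential growth forbids at a suitable
radius.

Borel half (`exists_isBorelColoring_of_isExtendable_closedBall`): choose a Borel maximal set of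
centres pairwise more than `2R + 1` apart, and let `X` be the union of their `R`-balls. Off `X`,
colour greedily layer by layer towards `X`; each vertex still has an uncoloured neighbour one layer
closer, hence a free colour. The balls are disjoint with no edges between them, so extendability
completes the colouring on each ball independently. Labels that are injective on every ball leave
finitely many patterns to try, and taking the first that works is a Borel choice. -/

/-- A partial colouring, with uncoloured vertices mapped to `none`, is proper on its domain. -/
def IsPartialColoring {V : Type*} (G : SimpleGraph V) {k : ℕ} (c : V → Option (Fin k)) : Prop :=
  ∀ v w, G.Adj v w → ∀ a, c v = some a → c w ≠ some a

/-- The colour `a` does not occur on the neighbours of `v`. -/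
def IsFree {V : Type*} (G : SimpleGraph V) {k : ℕ} (c : V → Option (Fin k)) (v : V)
    (a : Fin k) : Prop :=
  ∀ w, G.Adj v w → c w ≠ some a

/-- Every partial `k`-colouring that is undefined on `H` extends to `H`. -/
def IsExtendable {V : Type*} (G : SimpleGraph V) (k : ℕ) (H : Set V) : Prop :=
  ∀ c : V → Option (Fin k), IsPartialColoring G c → (∀ v ∈ H, c v = none) →
    ∃ c' : V → Option (Fin k), IsPartialColoring G c' ∧ (∀ v, v ∉ H → c' v = c v) ∧
      ∀ v ∈ H, c' v ≠ none

/-! ### Extendable sets and even cycles -/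

section Extension

variable {V : Type*} {G : SimpleGraph V} {k : ℕ} {c : V → Option (Fin k)}

open Classical in
theorem IsPartialColoring.update (hc : IsPartialColoring G c) {v : V} {a : Fin k}
    (ha : IsFree G c v a) : IsPartialColoring G (Function.update c v (some a)) := by
  intro x y hxy b hx hy
  by_cases h1 : x = v
  · subst h1
    rw [Function.update_self] at hx
    rw [Function.update_of_ne hxy.ne'] at hy
    exact ha y hxy (hy.trans hx.symm)
  · rw [Function.update_of_ne h1] at hx
    by_cases h2 : y = v
    · subst h2
      rw [Function.update_self] at hy
      exact ha x hxy.symm (hx.trans hy.symm)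
    · rw [Function.update_of_ne h2] at hy
      exact hc x y hxy b hx hy

/-- If no colour is free at `v`, then the colours of some neighbours of `v` exhaust the palette. -/
theorem exists_transversal_of_not_free {v : V} (h : ¬ ∃ a, IsFree G c v a) :
    ∃ w : Fin k → V, Function.Injective w ∧ ∀ a, G.Adj v (w a) ∧ c (w a) = some a := by
  simp only [IsFree, not_exists, not_forall, not_not] at h
  choose w h1 h2 using h
  refine ⟨w, fun a b hab => ?_, fun a => ⟨h1 a, h2 a⟩⟩
  have := (h2 a).symm.trans ((congrArg c hab).trans (h2 b))
  exact Option.some_injective _ this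

theorem encard_range_fin {w : Fin k → V} (hw : Function.Injective w) :
    (Set.range w).encard = k := by
  rw [← Set.image_univ, hw.encard_image, Set.encard_univ]
  simp

theorem exists_free_of_degree_lt {v : V} (h : (G.neighborSet v).encard < k) :
    ∃ a, IsFree G c v a := by
  by_contra hno
  obtain ⟨w, hw, hadj⟩ := exists_transversal_of_not_free hno
  have : (Set.range w).encard ≤ (G.neighborSet v).encard :=
    Set.encard_le_encard (by rintro _ ⟨a, rfl⟩; exact (hadj a).1)
  rw [encard_range_fin hw] at this
  exact absurd h (not_lt.2 this)

/-- If every colour occurred around `v`, the at most `k` neighbours would carry the `k` colours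
bijectively; an uncoloured neighbour or a repetition breaks this count. -/
theorem exists_free {v : V} (hdeg : (G.neighborSet v).encard ≤ k)
    (h : (∃ u, G.Adj v u ∧ c u = none) ∨
      ∃ u₁ u₂, u₁ ≠ u₂ ∧ G.Adj v u₁ ∧ G.Adj v u₂ ∧ c u₁ = c u₂) :
    ∃ a, IsFree G c v a := by
  by_contra hno
  obtain ⟨w, hw, hadj⟩ := exists_transversal_of_not_free hno
  have heq : Set.range w = G.neighborSet v :=
    (Set.finite_of_encard_le_coe hdeg).eq_of_subset_of_encard_le' (by rintro _ ⟨a, rfl⟩; exact (hadj a).1)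
      (by rw [encard_range_fin hw]; exact hdeg)
  have key : ∀ u, G.Adj v u → ∃ a, w a = u := fun u hu => by
    have : u ∈ Set.range w := heq ▸ hu
    exact this
  rcases h with ⟨u, hu, hcu⟩ | ⟨u₁, u₂, hne, h₁, h₂, h12⟩
  · obtain ⟨a, rfl⟩ := key u hu
    rw [(hadj a).2] at hcu
    cases hcu
  · obtain ⟨a, rfl⟩ := key u₁ h₁
    obtain ⟨b, rfl⟩ := key u₂ h₂
    rw [(hadj a).2, (hadj b).2] at h12
    exact hne (congrArg w (Option.some_injective _ h12))

theorem isExtendable_singleton {v : V} (h : (G.neighborSet v).encard < k) :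
    IsExtendable G k {v} := by
  classical
  intro c hc _
  obtain ⟨a, ha⟩ := exists_free_of_degree_lt (c := c) h
  refine ⟨Function.update c v (some a), hc.update ha, fun u hu => ?_, ?_⟩
  · exact Function.update_of_ne hu _ _
  · rintro u rfl
    simp

/-- Colour `v` first, while its neighbour `u` is still uncoloured and so guarantees a free colour;
extendability of `H` applies to whatever colouring results. -/
theorem IsExtendable.insert_of_adj {H : Set V} (hH : IsExtendable G k H)
    {u v : V} (hdeg : (G.neighborSet v).encard ≤ k) (hu : u ∈ H) (hvu : G.Adj v u) :
    IsExtendable G k (insert v H) := by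
  classical
  intro c hc hnone
  by_cases hv : v ∈ H
  · rw [Set.insert_eq_of_mem hv] at hnone ⊢
    exact hH c hc hnone
  obtain ⟨a, ha⟩ := exists_free (c := c) hdeg
    (Or.inl ⟨u, hvu, hnone u (Set.mem_insert_of_mem _ hu)⟩)
  obtain ⟨c', h1, h2, h3⟩ := hH _ (hc.update ha) (fun x hx => by
    rw [Function.update_of_ne (by rintro rfl; exact hv hx)]
    exact hnone x (Set.mem_insert_of_mem _ hx))
  refine ⟨c', h1, fun x hx => ?_, ?_⟩
  · rw [Set.mem_insert_iff, not_or] at hx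
    rw [h2 x hx.2, Function.update_of_ne hx.1]
  · rintro x (rfl | hx)
    · rw [h2 x hv]
      simp
    · exact h3 x hx

/-- An uncoloured path can be coloured greedily up to its last vertex. -/
theorem exists_color_path (hdeg : ∀ v, (G.neighborSet v).encard ≤ k) (n : ℕ) :
    ∀ (g : ℕ → V) (c : V → Option (Fin k)), IsPartialColoring G c →
      (∀ j < n, G.Adj (g j) (g (j + 1))) → Set.InjOn g (Set.Iic n) →
      (∀ j ≤ n, c (g j) = none) →
      ∃ c' : V → Option (Fin k), IsPartialColoring G c' ∧
        (∀ v, (∀ j < n, v ≠ g j) → c' v = c v) ∧ ∀ j < n, c' (g j) ≠ none := by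
  classical
  induction n with
  | zero => exact fun g c hc _ _ _ => ⟨c, hc, fun _ _ => rfl, fun j hj => absurd hj (by simp)⟩
  | succ n ih =>
    intro g c hc hadj hinj hnone
    obtain ⟨a, ha⟩ := exists_free (c := c) (hdeg (g 0))
      (Or.inl ⟨g 1, hadj 0 (by lia), hnone 1 (by lia)⟩)
    have hne : ∀ j ≤ n, g (j + 1) ≠ g 0 := fun j hj h => by
      have := hinj (by simp; lia : j + 1 ∈ Set.Iic (n + 1)) (by simp) h
      lia
    obtain ⟨c', h1, h2, h3⟩ := ih (fun j => g (j + 1)) _ (hc.update ha)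
      (fun j hj => hadj (j + 1) (by lia))
      (fun i hi j hj hij => by
        have := hinj (by simp at hi ⊢; lia : i + 1 ∈ Set.Iic (n + 1))
          (by simp at hj ⊢; lia : j + 1 ∈ Set.Iic (n + 1)) hij
        lia)
      (fun j hj => by
        rw [Function.update_of_ne (hne j hj)]
        exact hnone _ (by lia))
    refine ⟨c', h1, fun v hv => ?_, fun j hj => ?_⟩
    · rw [h2 v (fun j hj => hv (j + 1) (by lia)), Function.update_of_ne (hv 0 (by lia))]
    · rcases j with _ | j
      · rw [h2 (g 0) (fun j hj => (hne j (by lia)).symm)]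
        simp
      · exact h3 j (by lia)

/-- An uncoloured path can be coloured entirely if its last vertex sees an uncoloured vertex or
two vertices of the same colour off the path. -/
theorem exists_color_full_path (hdeg : ∀ v, (G.neighborSet v).encard ≤ k) {n : ℕ}
    {g : ℕ → V} (hc : IsPartialColoring G c)
    (hadj : ∀ j < n, G.Adj (g j) (g (j + 1))) (hinj : Set.InjOn g (Set.Iic n))
    (hnone : ∀ j ≤ n, c (g j) = none)
    (hend : (∃ u, G.Adj (g n) u ∧ (∀ j ≤ n, u ≠ g j) ∧ c u = none) ∨
      ∃ u₁ u₂, u₁ ≠ u₂ ∧ (G.Adj (g n) u₁ ∧ ∀ j ≤ n, u₁ ≠ g j) ∧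
        (G.Adj (g n) u₂ ∧ ∀ j ≤ n, u₂ ≠ g j) ∧ c u₁ = c u₂) :
    ∃ c' : V → Option (Fin k), IsPartialColoring G c' ∧
      (∀ v, (∀ j ≤ n, v ≠ g j) → c' v = c v) ∧ ∀ j ≤ n, c' (g j) ≠ none := by
  classical
  obtain ⟨c', h1, h2, h3⟩ := exists_color_path hdeg n g c hc hadj hinj hnone
  have h2' : ∀ v, (∀ j ≤ n, v ≠ g j) → c' v = c v := fun v hv => h2 v fun j hj => hv j hj.le
  obtain ⟨a, ha⟩ := exists_free (c := c') (hdeg (g n)) (by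
    rcases hend with ⟨u, hu, hn, hcu⟩ | ⟨u₁, u₂, hne, ⟨h₁, hn₁⟩, ⟨h₂, hn₂⟩, h12⟩
    · exact Or.inl ⟨u, hu, by rw [h2' u hn, hcu]⟩
    · exact Or.inr ⟨u₁, u₂, hne, h₁, h₂, by rw [h2' _ hn₁, h2' _ hn₂, h12]⟩)
  refine ⟨_, h1.update ha, fun v hv => ?_, fun j hj => ?_⟩
  · rw [Function.update_of_ne (hv n le_rfl), h2' v hv]
  · rcases hj.lt_or_eq with hj | rfl
    · by_cases h : g j = g n
      · rw [h]; simp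
      · rw [Function.update_of_ne h]
        exact h3 j hj
    · simp

/-- The vertex set of an even cycle is extendable if its vertices have full degree and one of them
has at most two neighbours in the set. -/
theorem isExtendable_range_of_periodic (hdeg : ∀ v, (G.neighborSet v).encard ≤ k) {F : ℕ → V}
    {N : ℕ} (hN : 4 ≤ N) (heven : Even N) (hadj : ∀ i, G.Adj (F i) (F (i + 1)))
    (hF : ∀ i j, F i = F j ↔ i ≡ j [MOD N]) (hfull : ∀ i, (G.neighborSet (F i)).encard = k)
    {i₀ : ℕ} {p q : V} (hpq : ∀ j, G.Adj (F i₀) (F j) → F j = p ∨ F j = q) :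
    IsExtendable G k (Set.range F) := by
  classical
  by_contra hnot
  simp only [IsExtendable, not_forall] at hnot
  obtain ⟨c, hc, hnone, hno⟩ := hnot
  replace hnone : ∀ i, c (F i) = none := fun i => hnone _ ⟨i, rfl⟩
  replace hno : ∀ c' : V → Option (Fin k), IsPartialColoring G c' →
      (∀ v, v ∉ Set.range F → c' v = c v) → ∃ i, c' (F i) = none := by
    intro c' h1 h2
    by_contra! h3
    exact hno ⟨c', h1, h2, by rintro _ ⟨i, rfl⟩; exact h3 i⟩
  have hper : ∀ i, F (i + N) = F i := fun i => (hF _ _).2 (by simp [Nat.ModEq])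
  have hcover : ∀ s m, ∃ j < N, F (s + j) = F m := fun s m => by
    refine ⟨(m + s * (N - 1)) % N, Nat.mod_lt _ (by lia), (hF _ _).2 ?_⟩
    have h1 : s + (m + s * (N - 1)) % N ≡ s + (m + s * (N - 1)) [MOD N] :=
      Nat.ModEq.add_left _ (Nat.mod_modEq _ _)
    refine h1.trans ?_
    have : s + (m + s * (N - 1)) = m + s * N := by
      obtain ⟨M, rfl⟩ : ∃ M, N = M + 1 := ⟨N - 1, by lia⟩
      simp; ring
    rw [this]
    simp [Nat.ModEq]
  have hinj : ∀ s n, n < N → Set.InjOn (fun j => F (s + j)) (Set.Iic n) := by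
    intro s n hn i hi j hj hij
    have h := (hF _ _).1 hij
    have h' : i ≡ j [MOD N] := Nat.ModEq.add_left_cancel' s h
    exact Nat.ModEq.eq_of_lt_of_lt h' (lt_of_le_of_lt hi hn) (lt_of_le_of_lt hj hn)
  -- the neighbours off the cycle are coloured with distinct colours
  have hend : ∀ i, ¬ ((∃ u, G.Adj (F i) u ∧ u ∉ Set.range F ∧ c u = none) ∨
      ∃ u₁ u₂, u₁ ≠ u₂ ∧ (G.Adj (F i) u₁ ∧ u₁ ∉ Set.range F) ∧
        (G.Adj (F i) u₂ ∧ u₂ ∉ Set.range F) ∧ c u₁ = c u₂) := by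
    intro i h
    -- Colour once around the cycle, from `F (i + 1)` to `F i`; the slack among the off-cycle
    -- neighbours of `F i` serves the last vertex.
    have hlast : F (i + 1 + (N - 1)) = F i := by
      rw [← hper i]; congr 1; lia
    obtain ⟨c', h1, h2, h3⟩ := exists_color_full_path hdeg (n := N - 1)
      (g := fun j => F (i + 1 + j)) hc (fun j _ => hadj _) (hinj _ _ (by lia))
      (fun j _ => hnone _) (by
        have hoff : ∀ u, u ∉ Set.range F → ∀ j ≤ N - 1, u ≠ F (i + 1 + j) :=
          fun u hu j _ h => hu ⟨_, h.symm⟩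
        simp only [hlast]
        rcases h with ⟨u, hu, hr, hn⟩ | ⟨u₁, u₂, hne, ⟨ha, hr⟩, ⟨hb, hs⟩, h12⟩
        · exact Or.inl ⟨u, hu, hoff u hr, hn⟩
        · exact Or.inr ⟨u₁, u₂, hne, ⟨ha, hoff _ hr⟩, ⟨hb, hoff _ hs⟩, h12⟩)
    obtain ⟨m, hm⟩ := hno c' h1 (fun v hv => h2 v fun j _ h => hv ⟨_, h.symm⟩)
    obtain ⟨j, hj, hjm⟩ := hcover (i + 1) m
    exact h3 j (by lia) (by simp only [hjm]; exact hm)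
  -- all vertices of the cycle have the same free colours
  have hstep : ∀ i a, IsFree G c (F (i + 1)) a → IsFree G c (F i) a := by
    intro i a ha
    by_contra hb
    simp only [IsFree, not_forall, not_not] at hb
    obtain ⟨u, hu, hcu⟩ := hb
    have hur : u ∉ Set.range F := by
      rintro ⟨m, rfl⟩
      rw [hnone] at hcu
      cases hcu
    -- Give `F (i + 1)` the colour `a`. Then `F i` sees `a` twice, on `F (i + 1)` and on `u`, so the
    -- remaining path from `F (i + 2)` round to `F i` can be coloured.
    have hlast : F (i + 2 + (N - 2)) = F i := by
      rw [← hper i]; congr 1; lia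
    have hne : ∀ j ≤ N - 2, F (i + 2 + j) ≠ F (i + 1) := fun j hj h => by
      have h' := (hF _ _).1 h
      have h'' : 1 + j ≡ 0 [MOD N] := by
        apply Nat.ModEq.add_left_cancel' (i + 1)
        convert h' using 1
        ring
      have := Nat.ModEq.eq_of_lt_of_lt h'' (by lia) (by lia)
      lia
    obtain ⟨c', h1, h2, h3⟩ := exists_color_full_path hdeg (n := N - 2)
      (g := fun j => F (i + 2 + j)) (hc.update ha) (fun j _ => hadj _) (hinj _ _ (by lia))
      (fun j hj => by
        rw [Function.update_of_ne (hne j hj)]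
        exact hnone _) (by
        simp only [hlast]
        refine Or.inr ⟨F (i + 1), u, fun h => hur ⟨_, h⟩, ⟨hadj i, fun j hj => (hne j hj).symm⟩,
          ⟨hu, fun j _ h => hur ⟨_, h.symm⟩⟩, ?_⟩
        rw [Function.update_self, Function.update_of_ne (fun h => hur ⟨_, h.symm⟩), hcu])
    obtain ⟨m, hm⟩ := hno c' h1 (fun v hv => by
      rw [h2 v fun j _ h => hv ⟨_, h.symm⟩, Function.update_of_ne fun h => hv ⟨_, h.symm⟩])
    obtain ⟨j, hj, hjm⟩ := hcover (i + 2) m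
    rcases (show j ≤ N - 2 ∨ j = N - 1 by lia) with hj' | hj'
    · exact h3 j hj' (by simp only [hjm]; exact hm)
    · have : F m = F (i + 1) := by
        rw [← hjm, ← hper (i + 1)]; congr 1; lia
      rw [this, h2 _ fun j hj => (hne j hj).symm, Function.update_self] at hm
      cases hm
  have hle : ∀ i d a, IsFree G c (F (i + d)) a → IsFree G c (F i) a := by
    intro i d a
    induction d with
    | zero => exact id
    | succ d ih => exact fun h => ih (hstep _ a h)
  have hfree : ∀ i a, IsFree G c (F i) a ↔ IsFree G c (F 0) a := by
    refine fun i a => ⟨fun h => hle 0 i a (by rwa [zero_add]), fun h => ?_⟩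
    -- `hle` only carries freeness backwards; moving `i * (N - 1)` further from index `i` reaches a
    -- multiple of `N`, hence `F 0` again.
    refine hle i (i * (N - 1)) a ?_
    have : F (i + i * (N - 1)) = F 0 := by
      rw [hF]
      have : i + i * (N - 1) = i * N := by
        obtain ⟨M, rfl⟩ : ∃ M, N = M + 1 := ⟨N - 1, by lia⟩
        simp; ring
      rw [this]
      simp [Nat.ModEq]
    rwa [this]
  set L : Set (Fin k) := {a | IsFree G c (F 0) a} with hL
  have hfin : ∀ i, (G.neighborSet (F i)).Finite := fun i =>
    Set.finite_of_encard_le_coe (hfull i).le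
  -- Among the `k` neighbours of `F i`, those off the cycle carry each non-free colour exactly once,
  -- so the number on the cycle equals the number of free colours.
  have hcard : ∀ i, (G.neighborSet (F i) ∩ Set.range F).ncard = L.ncard := by
    intro i
    have h1 := Set.ncard_inter_add_ncard_sdiff_eq_ncard (G.neighborSet (F i)) (Set.range F) (hfin i)
    have h2 : (G.neighborSet (F i)).ncard = k := by
      rw [Set.ncard, hfull i]; simp
    have h3 : (G.neighborSet (F i) \ Set.range F).ncard = Lᶜ.ncard := by
      have himg : c '' (G.neighborSet (F i) \ Set.range F) = some '' Lᶜ := by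
        ext o
        constructor
        · rintro ⟨u, ⟨hu, hur⟩, rfl⟩
          rcases hcu : c u with _ | a
          · exact absurd (Or.inl ⟨u, hu, hur, hcu⟩) (hend i)
          · exact ⟨a, fun ha => (hfree i a).2 ha u hu hcu, rfl⟩
        · rintro ⟨a, ha, rfl⟩
          have ha' : ¬ IsFree G c (F i) a := fun h => ha ((hfree i a).1 h)
          simp only [IsFree, not_forall, not_not] at ha'
          obtain ⟨u, hu, hcu⟩ := ha'
          refine ⟨u, ⟨hu, ?_⟩, hcu⟩
          rintro ⟨m, rfl⟩
          rw [hnone] at hcu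
          cases hcu
      rw [← Set.ncard_image_of_injective Lᶜ (Option.some_injective _), ← himg,
        Set.InjOn.ncard_image]
      intro u₁ hu₁ u₂ hu₂ h12
      by_contra hne
      exact hend i (Or.inr ⟨u₁, u₂, hne, hu₁, hu₂, h12⟩)
    have h4 := Set.ncard_add_ncard_compl L
    rw [Nat.card_eq_fintype_card, Fintype.card_fin] at h4
    lia
  have hL2 : L.ncard ≤ 2 := by
    rw [← hcard i₀]
    refine (Set.ncard_le_ncard (t := {p, q}) ?_ (Set.toFinite _)).trans ((Set.ncard_insert_le p {q}).trans
      (by rw [Set.ncard_singleton]))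
    rintro _ ⟨hu, j, rfl⟩
    exact hpq j hu
  have hpair : ∀ i, ({F (i + 1), F (i + (N - 1))} : Set V) ⊆ G.neighborSet (F i) ∩ Set.range F := by
    rintro i _ (rfl | rfl)
    · exact ⟨hadj i, _, rfl⟩
    · refine ⟨?_, _, rfl⟩
      have := (hadj (i + (N - 1))).symm
      rw [show i + (N - 1) + 1 = i + N by lia, hper] at this
      exact this
  have hpair2 : ∀ i, ({F (i + 1), F (i + (N - 1))} : Set V).ncard = 2 := fun i =>
    Set.ncard_pair fun h => by
      have h' : 1 ≡ N - 1 [MOD N] := Nat.ModEq.add_left_cancel' i ((hF _ _).1 h)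
      have := Nat.ModEq.eq_of_lt_of_lt h' (by lia) (by lia)
      lia
  -- The bound at `i₀` is passed on to all vertices by `hcard`: the cycle is induced and exactly two
  -- colours are free. As its length is even, these two can alternate.
  have hnbr : ∀ i, G.neighborSet (F i) ∩ Set.range F = {F (i + 1), F (i + (N - 1))} := fun i =>
    (Set.eq_of_subset_of_ncard_le (hpair i) (by rw [hpair2, hcard]; exact hL2)
      ((hfin i).inter_of_left _)).symm
  obtain ⟨α, β, hαβ, hLab⟩ := Set.ncard_eq_two.1 (by rw [← hcard 0, hnbr, hpair2] : L.ncard = 2)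
  have hfreeα : ∀ i, IsFree G c (F i) α := fun i => (hfree i α).2 (by
    have : α ∈ L := by rw [hLab]; simp
    exact this)
  have hfreeβ : ∀ i, IsFree G c (F i) β := fun i => (hfree i β).2 (by
    have : β ∈ L := by rw [hLab]; simp
    exact this)
  set c' : V → Option (Fin k) := fun v =>
    if ∃ i, F i = v ∧ Even i then some α else if v ∈ Set.range F then some β else c v with hc'
  have hpar : ∀ i j, F i = F j → (Even i ↔ Even j) := fun i j h => by
    have h1 : i ≡ j [MOD 2] := ((hF _ _).1 h).of_dvd heven.two_dvd
    rw [Nat.even_iff, Nat.even_iff, h1]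
  have hceven : ∀ i, Even i → c' (F i) = some α := fun i hi => if_pos ⟨i, rfl, hi⟩
  have hcodd : ∀ i, ¬ Even i → c' (F i) = some β := fun i hi => by
    rw [hc']
    simp only
    rw [if_neg (fun ⟨j, hj, hj'⟩ => hi ((hpar _ _ hj).1 hj')), if_pos ⟨i, rfl⟩]
  have hcoff : ∀ v, v ∉ Set.range F → c' v = c v := fun v hv => by
    rw [hc']
    simp only
    rw [if_neg (fun ⟨j, hj, _⟩ => hv ⟨j, hj⟩), if_neg hv]
  have hadjpar : ∀ i j, G.Adj (F i) (F j) → (Even i ↔ ¬ Even j) := by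
    intro i j h
    have : F j ∈ G.neighborSet (F i) ∩ Set.range F := ⟨h, j, rfl⟩
    rw [hnbr] at this
    have h1 : ¬ Even (N - 1) := by
      rw [Nat.even_sub (by lia)]; simp [heven]
    rcases this with h | h
    · rw [hpar _ _ h, Nat.even_add_one, not_not]
    · rw [hpar _ _ h, Nat.even_add]; tauto
  have hmix : ∀ i w, w ∉ Set.range F → G.Adj (F i) w → c' (F i) ≠ c' w := by
    intro i w hw h he
    rw [hcoff w hw] at he
    by_cases hi : Even i
    · rw [hceven i hi] at he
      exact hfreeα i w h he.symm
    · rw [hcodd i hi] at he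
      exact hfreeβ i w h he.symm
  obtain ⟨m, hm⟩ := hno c' (by
    intro v w hvw a hv hw
    by_cases h1 : v ∈ Set.range F
    · obtain ⟨i, rfl⟩ := h1
      by_cases h2 : w ∈ Set.range F
      · obtain ⟨j, rfl⟩ := h2
        have := hadjpar i j hvw
        by_cases hi : Even i
        · have hj : ¬ Even j := this.1 hi
          rw [hceven i hi] at hv
          rw [hcodd j hj] at hw
          exact hαβ (Option.some_injective _ (hv.trans hw.symm))
        · have hj : Even j := by tauto
          rw [hcodd i hi] at hv
          rw [hceven j hj] at hw
          exact hαβ (Option.some_injective _ (hw.trans hv.symm))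
      · exact hmix i w h2 hvw (hv.trans hw.symm)
    · by_cases h2 : w ∈ Set.range F
      · obtain ⟨j, rfl⟩ := h2
        exact hmix j v h1 hvw.symm (hw.trans hv.symm)
      · rw [hcoff v h1] at hv
        rw [hcoff w h2] at hw
        exact hc v w hvw a hv hw) hcoff
  by_cases h : Even m
  · rw [hceven m h] at hm; cases hm
  · rw [hcodd m h] at hm; cases hm

/-- The path and the edge `y x` form a cycle of even length `p.length + 1`; reading the path's
indices modulo this length gives the periodic parametrisation. -/
theorem isExtendable_support (hdeg : ∀ v, (G.neighborSet v).encard ≤ k) {x y : V}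
    {p : G.Walk x y} (hp : p.IsPath) (hodd : Odd p.length) (hlen : 3 ≤ p.length)
    (hyx : G.Adj y x) (hfull : ∀ v ∈ p.support, (G.neighborSet v).encard = k)
    {v a b : V} (hv : v ∈ p.support) (hab : ∀ u ∈ p.support, G.Adj v u → u = a ∨ u = b) :
    IsExtendable G k {u | u ∈ p.support} := by
  set N := p.length + 1 with hN
  have hmem : ∀ j, p.getVert j ∈ p.support := fun j => p.getVert_mem_support j
  have hrange : Set.range (fun i => p.getVert (i % N)) = {u | u ∈ p.support} := by
    ext u
    constructor
    · rintro ⟨i, rfl⟩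
      exact hmem _
    · intro hu
      obtain ⟨n, rfl, hn⟩ := SimpleGraph.Walk.mem_support_iff_exists_getVert.1 hu
      exact ⟨n, by simp only [Nat.mod_eq_of_lt (show n < N by lia)]⟩
  rw [← hrange]
  obtain ⟨n, rfl, hn⟩ := SimpleGraph.Walk.mem_support_iff_exists_getVert.1 hv
  refine isExtendable_range_of_periodic hdeg (N := N) (by lia) (by simpa [hN, parity_simps])
    (fun i => ?_) (fun i j => ⟨fun h => ?_, fun h => ?_⟩) (fun i => hfull _ (hmem _)) (i₀ := n)
    (p := a) (q := b) ?_
  · have hlt : i % N < N := Nat.mod_lt _ (by lia)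
    rw [Nat.add_mod]
    rcases (show i % N < p.length ∨ i % N = p.length by lia) with h | h
    · rw [Nat.mod_eq_of_lt (show 1 < N by lia), Nat.mod_eq_of_lt (show i % N + 1 < N by lia)]
      exact p.adj_getVert_succ h
    · rw [Nat.mod_eq_of_lt (show 1 < N by lia), h, Nat.mod_self, p.getVert_length,
        p.getVert_zero]
      exact hyx
  · have hi : i % N < N := Nat.mod_lt _ (by lia)
    have hj : j % N < N := Nat.mod_lt _ (by lia)
    exact hp.getVert_injOn (show i % N ≤ p.length by lia) (show j % N ≤ p.length by lia) h
  · rw [show i % N = j % N from h]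
  · intro j hj
    simp only [Nat.mod_eq_of_lt (show n < N by lia)] at hj
    exact hab _ (hmem _) hj

end Extension

/-! ### Breadth-first layers of a rigid ball and their growth -/

section Growth

variable {V : Type*} {G : SimpleGraph V} {k : ℕ} {r : V}

theorem dist_le_succ_of_adj {u w : V} (hu : G.Reachable r u) (h : G.Adj u w) :
    G.dist r w ≤ G.dist r u + 1 := by
  obtain ⟨p, hp⟩ := hu.exists_walk_length_eq_dist
  rw [← hp]
  simpa using G.dist_le (p.concat h)

theorem exists_adj_dist_succ {u : V} (hu : G.Reachable r u) (h : G.dist r u ≠ 0) :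
    ∃ p, G.Adj p u ∧ G.Reachable r p ∧ G.dist r p + 1 = G.dist r u := by
  obtain ⟨w, hw⟩ := hu.exists_walk_length_eq_dist
  have hnil : ¬ w.Nil := by
    rw [← SimpleGraph.Walk.length_eq_zero_iff]
    lia
  have hadj := w.adj_penultimate hnil
  have hr : G.Reachable r w.penultimate := w.dropLast.reachable
  refine ⟨w.penultimate, hadj, hr, ?_⟩
  have h1 := dist_le_succ_of_adj hr hadj
  have h2 := G.dist_le w.dropLast
  have h3 : w.dropLast.length = w.length - 1 := by simp
  lia

/-- Two vertices at the same distance from the root are joined through their ancestors. -/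
theorem exists_ancestral_path (n : ℕ) : ∀ x y : V, G.Reachable r x → G.Reachable r y →
    G.dist r x = n → G.dist r y = n → x ≠ y →
    ∃ (p : G.Walk x y) (m : ℕ) (t a b : V), p.IsPath ∧ p.length = 2 * m ∧ 1 ≤ m ∧
      t ∈ p.support ∧ G.dist r t + m = n ∧ (∀ u ∈ p.support, G.Reachable r u) ∧
      (∀ u ∈ p.support, u = x ∨ u = y ∨ G.dist r u < n) ∧
      (∀ u ∈ p.support, u = t ∨ G.dist r t < G.dist r u) ∧
      ∀ u ∈ p.support, G.dist r u = G.dist r t + 1 → u = a ∨ u = b := by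
  induction n with
  | zero =>
    intro x y hx hy h1 h2 hne
    exact absurd ((hx.dist_eq_zero_iff.1 h1).symm.trans (hy.dist_eq_zero_iff.1 h2)) hne
  | succ n ih =>
    intro x y hx hy h1 h2 hne
    -- Replace both ends by parents. Where the two lines meet is the top vertex `t`, and `a`, `b`
    -- are the path vertices just below it; longer paths inherit all three.
    obtain ⟨x', hxa, hxr, hxd⟩ := exists_adj_dist_succ hx (by lia)
    obtain ⟨y', hya, hyr, hyd⟩ := exists_adj_dist_succ hy (by lia)
    have hxx : x ≠ x' := hxa.ne'
    have hyy : y ≠ y' := hya.ne'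
    by_cases h : x' = y'
    · subst h
      refine ⟨.cons hxa.symm (.cons hya .nil), 1, x', x, y, ?_, rfl, le_rfl, ?_, ?_, ?_, ?_,
        ?_, ?_⟩
      · simp [SimpleGraph.Walk.cons_isPath_iff, hne, hxx, hyy.symm]
      · simp
      · lia
      · simp [hx, hy, hxr]
      · simp; lia
      · simp; lia
      · simp
    · obtain ⟨p, m, t, a, b, hp, hlen, hm, ht, htd, hr, hlev, htop, hab⟩ :=
        ih x' y' hxr hyr (by lia) (by lia) h
      have hlt : ∀ u ∈ p.support, G.dist r u < n + 1 := fun u hu => by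
        rcases hlev u hu with rfl | rfl | h <;> lia
      have hxs : x ∉ p.support := fun h => by have := hlt x h; lia
      have hys : y ∉ p.support := fun h => by have := hlt y h; lia
      have hmem : ∀ u, u ∈ ((SimpleGraph.Walk.cons hxa.symm p).concat hya).support ↔
          u = x ∨ u ∈ p.support ∨ u = y := by
        intro u
        simp [SimpleGraph.Walk.support_concat]
      refine ⟨(SimpleGraph.Walk.cons hxa.symm p).concat hya, m + 1, t, a, b, ?_, ?_, by lia, ?_,
        by lia, ?_, ?_, ?_, ?_⟩
      · refine SimpleGraph.Walk.IsPath.concat ?_ ?_ _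
        · exact (SimpleGraph.Walk.cons_isPath_iff _ _).2 ⟨hp, hxs⟩
        · simp [hys, hne.symm]
      · simp [hlen]; lia
      · rw [hmem]; exact Or.inr (Or.inl ht)
      · intro u hu
        rcases (hmem u).1 hu with rfl | h | rfl
        exacts [hx, hr u h, hy]
      · intro u hu
        rcases (hmem u).1 hu with rfl | h | rfl
        exacts [Or.inl rfl, Or.inr (Or.inr (hlt u h)), Or.inr (Or.inl rfl)]
      · intro u hu
        rcases (hmem u).1 hu with rfl | h | rfl
        exacts [Or.inr (by lia), htop u h, Or.inr (by lia)]
      · intro u hu hud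
        rcases (hmem u).1 hu with rfl | h | rfl
        exacts [by lia, hab u h hud, by lia]

/-- All degrees in the ball are maximal, and the ball contains no nonempty extendable set. -/
structure IsRigidBall {V : Type*} (G : SimpleGraph V) (k : ℕ) (r : V) (R : ℕ) : Prop where
  degree_le : ∀ v, (G.neighborSet v).encard ≤ k
  degree_eq : ∀ u, G.Reachable r u → G.dist r u ≤ R → (G.neighborSet u).encard = k
  not_extendable : ∀ H : Set V, H.Nonempty → (∀ u ∈ H, G.Reachable r u ∧ G.dist r u ≤ R) →
    ¬ IsExtendable G k H

variable {R : ℕ}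

theorem IsRigidBall.not_cycle (hR : IsRigidBall G k r R) {x y : V} {p : G.Walk x y}
    (hp : p.IsPath) (hodd : Odd p.length) (hlen : 3 ≤ p.length) (hyx : G.Adj y x)
    (hball : ∀ u ∈ p.support, G.Reachable r u ∧ G.dist r u ≤ R)
    {v a b : V} (hv : v ∈ p.support) (hab : ∀ u ∈ p.support, G.Adj v u → u = a ∨ u = b) :
    False :=
  hR.not_extendable _ ⟨v, hv⟩ hball (isExtendable_support hR.degree_le hp hodd hlen hyx
    (fun v hv => hR.degree_eq v (hball v hv).1 (hball v hv).2) hv hab)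

/-- Two parents joined by an ancestral path close up through `w` to an even cycle. All its other
vertices are at least two layers above `w`, so `w` has only the two parents as neighbours on it. -/
theorem IsRigidBall.parent_unique (hR : IsRigidBall G k r R) {w p q : V}
    (hw : G.Reachable r w) (hwR : G.dist r w ≤ R) (hp : G.Adj w p) (hq : G.Adj w q)
    (hpd : G.dist r p + 1 = G.dist r w) (hqd : G.dist r q + 1 = G.dist r w) : p = q := by
  by_contra hne
  obtain ⟨P, m, t, a, b, hP, hlen, hm, ht, htd, hr, hlev, htop, hab⟩ :=
    exists_ancestral_path (r := r) (G.dist r p) p q (hw.trans hp.reachable)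
      (hw.trans hq.reachable) rfl (by lia) hne
  have hlt : ∀ u ∈ P.support, G.dist r u < G.dist r w := fun u hu => by
    rcases hlev u hu with rfl | rfl | h <;> lia
  have hws : w ∉ P.support := fun h => lt_irrefl _ (hlt w h)
  refine hR.not_cycle (p := P.concat hq.symm) (hP.concat hws _)
    (by simp [hlen]) (by simp [hlen]; lia) hp
    (v := w) (a := p) (b := q) ?_ (by simp [SimpleGraph.Walk.support_concat]) ?_
  · intro u hu
    simp only [SimpleGraph.Walk.support_concat, List.mem_append,
      List.mem_singleton] at hu
    rcases hu with hu | rfl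
    · exact ⟨hr u hu, (hlt u hu).le.trans hwR⟩
    · exact ⟨hw, hwR⟩
  · intro u hu hwu
    simp only [SimpleGraph.Walk.support_concat, List.mem_append,
      List.mem_singleton] at hu
    rcases hu with hu | rfl
    · have := dist_le_succ_of_adj (hr u hu) hwu.symm
      rcases hlev u hu with h | h | h
      exacts [Or.inl h, Or.inr h, by lia]
    · exact absurd rfl hwu.ne

/-- An ancestral path from `x` to `y` closes up through `w` to an even cycle. Its top vertex `t` has
only two neighbours on it unless it is adjacent to `w`; hence `t` is the parent `p` and the cycle is
`w x p y`. Without the chord `x y`, the vertex `x` would have just two neighbours on this 4-cycle.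
-/
theorem IsRigidBall.siblings (hR : IsRigidBall G k r R) {w x y p : V}
    (hw : G.Reachable r w) (hwR : G.dist r w ≤ R) (hx : G.Adj w x) (hy : G.Adj w y)
    (hxd : G.dist r x = G.dist r w) (hyd : G.dist r y = G.dist r w) (hxy : x ≠ y)
    (hp : G.Adj w p) (hpd : G.dist r p + 1 = G.dist r w) :
    G.Adj x y ∧ G.Adj x p := by
  have hxr := hw.trans hx.reachable
  have hyr := hw.trans hy.reachable
  obtain ⟨P, m, t, a, b, hP, hlen, hm, ht, htd, hr, hlev, htop, hab⟩ :=
    exists_ancestral_path (r := r) (G.dist r w) x y hxr hyr hxd hyd hxy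
  have hws : w ∉ P.support := fun h => by
    rcases hlev w h with h | h | h
    exacts [hx.ne h, hy.ne h, lt_irrefl _ h]
  have hcyc : ∀ v a b, v ∈ P.support →
      (∀ u, u = w ∨ u ∈ P.support → G.Adj v u → u = a ∨ u = b) → False := by
    intro v a b hv hab
    refine hR.not_cycle (p := P.concat hy.symm) (hP.concat hws _)
      (by simp [hlen]) (by simp [hlen]; lia) hx
      (v := v) (a := a) (b := b) ?_ (by simp [SimpleGraph.Walk.support_concat, hv]) ?_
    · intro u hu
      simp only [SimpleGraph.Walk.support_concat, List.mem_append,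
        List.mem_singleton] at hu
      rcases hu with hu | rfl
      · refine ⟨hr u hu, ?_⟩
        rcases hlev u hu with rfl | rfl | h <;> lia
      · exact ⟨hw, hwR⟩
    · intro u hu
      simp only [SimpleGraph.Walk.support_concat, List.mem_append,
        List.mem_singleton] at hu
      exact hab u hu.symm
  have htw : G.Adj t w := by
    by_contra hno
    refine hcyc t a b ht ?_
    rintro u (rfl | hu) htu
    · exact absurd htu hno
    · refine hab u hu ?_
      have := dist_le_succ_of_adj (hr t ht) htu
      rcases htop u hu with rfl | h
      · exact absurd rfl htu.ne
      · lia
  have htd' := dist_le_succ_of_adj (hr t ht) htw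
  have htp : t = p := hR.parent_unique hw hwR htw.symm hp (by lia) hpd
  subst htp
  have hmem : ∀ u ∈ P.support, u = x ∨ u = y ∨ u = t := fun u hu => by
    rcases hlev u hu with h | h | h
    · exact Or.inl h
    · exact Or.inr (Or.inl h)
    · rcases htop u hu with h' | h'
      · exact Or.inr (Or.inr h')
      · lia
  constructor
  · by_contra hno
    refine hcyc x w t P.start_mem_support ?_
    rintro u (rfl | hu) hxu
    · exact Or.inl rfl
    · rcases hmem u hu with rfl | rfl | rfl
      · exact absurd rfl hxu.ne
      · exact absurd hxu hno
      · exact Or.inr rfl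
  · have hadj : G.Adj x P.snd := P.adj_snd (by
      rw [← SimpleGraph.Walk.length_eq_zero_iff]; lia)
    have hsnd : P.snd = t := by
      rcases hmem P.snd (P.getVert_mem_support 1) with h | h | h
      · exact absurd h.symm hadj.ne
      · have h1 := hP.getVert_injOn (show 1 ≤ P.length by lia) (show P.length ≤ P.length from le_rfl)
          (h.trans P.getVert_length.symm)
        lia
      · exact h
    rw [← hsnd]
    exact hadj

/-- The edges `v w`, `w x`, an ancestral path from `x` to `z'`, and the edges `z' z`, `z v` form an
even cycle. The only neighbours of `v` on it are `w` and `z`, since a neighbour on the ancestral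
path would be a second parent. The path is trivial if `x = z'`. -/
theorem IsRigidBall.no_lateral (hR : IsRigidBall G k r R) {v z w z' x : V}
    (hv : G.Reachable r v) (hvR : G.dist r v ≤ R) (hz : G.Adj v z)
    (hzd : G.dist r z = G.dist r v) (hw : G.Adj v w) (hwd : G.dist r w + 1 = G.dist r v)
    (hz' : G.Adj z z') (hzd' : G.dist r z' + 1 = G.dist r z) (hwz : w ≠ z')
    (hx : G.Adj w x) (hxd : G.dist r x = G.dist r w) : False := by
  have hwr := hv.trans hw.reachable
  have hxr := hwr.trans hx.reachable
  have hzr := hv.trans hz.reachable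
  have hzr' := hzr.trans hz'.reachable
  obtain ⟨P, hP, heven, hr, hlev⟩ : ∃ P : G.Walk x z', P.IsPath ∧ Even P.length ∧
      (∀ u ∈ P.support, G.Reachable r u) ∧
      ∀ u ∈ P.support, u = x ∨ u = z' ∨ G.dist r u < G.dist r w := by
    by_cases h : x = z'
    · subst h
      exact ⟨.nil, by simp, by simp, by simpa using hxr, by simp⟩
    · obtain ⟨P, m, t, a, b, hP, hlen, hm, ht, htd, hr, hlev, htop, hab⟩ :=
        exists_ancestral_path (r := r) (G.dist r w) x z' hxr hzr' hxd (by lia) h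
      exact ⟨P, hP, by simp [hlen], hr, hlev⟩
  have hle : ∀ u ∈ P.support, G.dist r u ≤ G.dist r w := fun u hu => by
    rcases hlev u hu with rfl | rfl | h <;> lia
  have hws : w ∉ P.support := fun h => by
    rcases hlev w h with h | h | h
    exacts [hx.ne h, hwz h, lt_irrefl _ h]
  have hzs : z ∉ (SimpleGraph.Walk.cons hx P).support := by
    rw [SimpleGraph.Walk.support_cons, List.mem_cons, not_or]
    exact ⟨fun h => by rw [h] at hzd; lia, fun h => by have := hle z h; lia⟩
  have hvs : v ∉ ((SimpleGraph.Walk.cons hx P).concat hz'.symm).support := by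
    rw [SimpleGraph.Walk.support_concat, SimpleGraph.Walk.support_cons]
    simp only [List.mem_append, List.mem_cons, List.not_mem_nil, or_false,
      not_or]
    exact ⟨⟨hw.ne, fun h => by have := hle v h; lia⟩, hz.ne⟩
  have hmem : ∀ u, u ∈ (((SimpleGraph.Walk.cons hx P).concat hz'.symm).concat hz.symm).support →
      u = w ∨ u ∈ P.support ∨ u = z ∨ u = v := by
    intro u hu
    simp only [SimpleGraph.Walk.support_concat, SimpleGraph.Walk.support_cons,
      List.mem_append, List.mem_cons, List.not_mem_nil, or_false] at hu
    tauto
  refine hR.not_cycle (p := ((SimpleGraph.Walk.cons hx P).concat hz'.symm).concat hz.symm)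
    (((((SimpleGraph.Walk.cons_isPath_iff _ _).2 ⟨hP, hws⟩)).concat hzs _).concat hvs _)
    ?_ ?_ hw ?_ (v := v) (a := w) (b := z) (by simp [SimpleGraph.Walk.support_concat]) ?_
  · simp only [SimpleGraph.Walk.length_concat, SimpleGraph.Walk.length_cons]
    simpa [parity_simps] using heven
  · simp only [SimpleGraph.Walk.length_concat, SimpleGraph.Walk.length_cons]
    lia
  · intro u hu
    rcases hmem u hu with rfl | h | rfl | rfl
    · exact ⟨hwr, by lia⟩
    · exact ⟨hr u h, by have := hle u h; lia⟩
    · exact ⟨hzr, by lia⟩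
    · exact ⟨hv, hvR⟩
  · intro u hu hvu
    rcases hmem u hu with rfl | h | rfl | rfl
    · exact Or.inl rfl
    · have h1 := dist_le_succ_of_adj (hr u h) hvu.symm
      have h2 := hle u h
      exact Or.inl (hR.parent_unique hv hvR hvu hw (by lia) hwd)
    · exact Or.inr rfl
    · exact absurd rfl hvu.ne

/-- The neighbours of `w` at distance `d` from the root. -/
def neighborsAt {V : Type*} (G : SimpleGraph V) (r w : V) (d : ℕ) : Set V :=
  {x | G.Adj w x ∧ G.dist r x = d}

theorem IsRigidBall.finite_neighborsAt (hR : IsRigidBall G k r R) (w : V) (d : ℕ) :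
    (neighborsAt G r w d).Finite :=
  (Set.finite_of_encard_le_coe (hR.degree_le w)).subset fun _ hx => hx.1

theorem IsRigidBall.card_neighbors (hR : IsRigidBall G k r R) {w : V} {n : ℕ}
    (hw : G.Reachable r w) (hwR : n + 1 ≤ R) (hn : G.dist r w = n + 1) :
    1 + (neighborsAt G r w (n + 1)).ncard + (neighborsAt G r w (n + 2)).ncard = k := by
  have h1 : (neighborsAt G r w n).ncard = 1 := by
    obtain ⟨p, hp, hpr, hpd⟩ := exists_adj_dist_succ hw (by lia)
    rw [Set.ncard_eq_one]
    refine ⟨p, Set.eq_singleton_iff_unique_mem.2 ⟨⟨hp.symm, by lia⟩, fun q hq => ?_⟩⟩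
    exact hR.parent_unique hw (by lia) hq.1 hp.symm (by rw [hq.2, hn]) hpd
  have hunion : G.neighborSet w =
      neighborsAt G r w n ∪ neighborsAt G r w (n + 1) ∪ neighborsAt G r w (n + 2) := by
    ext x
    simp only [neighborsAt, SimpleGraph.mem_neighborSet, Set.mem_union, Set.mem_ofPred_eq]
    constructor
    · intro h
      have h2 := dist_le_succ_of_adj hw h
      have h3 := dist_le_succ_of_adj (hw.trans h.reachable) h.symm
      have : G.dist r x = n ∨ G.dist r x = n + 1 ∨ G.dist r x = n + 2 := by lia
      tauto
    · tauto
  have hk : (G.neighborSet w).ncard = k := by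
    rw [Set.ncard, hR.degree_eq w hw (by lia)]; simp
  have hdisj : ∀ d e, d ≠ e → Disjoint (neighborsAt G r w d) (neighborsAt G r w e) :=
    fun d e h => Set.disjoint_left.2 fun x hx hy => h (hx.2.symm.trans hy.2)
  have hf := hR.finite_neighborsAt w
  rw [← hk, hunion, Set.ncard_union_eq _ ((hf _).union (hf _)) (hf _),
    Set.ncard_union_eq (hdisj _ _ (by lia)) (hf _) (hf _), h1]
  exact Set.disjoint_union_left.2 ⟨hdisj _ _ (by lia), hdisj _ _ (by lia)⟩

/-- By `siblings`, `k - 1` neighbours in the layer of `w` would form a `(k + 1)`-clique with `w` and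
its parent. Since `k - 1 ≥ 2`, each of them has a sibling to witness its adjacency to the parent. -/
theorem IsRigidBall.card_lateral (hR : IsRigidBall G k r R) (hk : 3 ≤ k)
    (hclique : G.CliqueFree (k + 1)) {w : V} {n : ℕ}
    (hw : G.Reachable r w) (hwR : n + 1 ≤ R) (hn : G.dist r w = n + 1) :
    (neighborsAt G r w (n + 1)).ncard + 2 ≤ k := by
  classical
  by_contra hlt
  obtain ⟨p, hp, hpr, hpd⟩ := exists_adj_dist_succ hw (by lia)
  have hf := hR.finite_neighborsAt w (n + 1)
  rw [Set.ncard_eq_toFinset_card _ hf] at hlt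
  obtain ⟨T, hT, hTc⟩ := Finset.exists_subset_card_eq (show k - 1 ≤ hf.toFinset.card by lia)
  have hT' : ∀ x ∈ T, G.Adj w x ∧ G.dist r x = n + 1 := fun x hx => by
    have := hT hx
    rwa [Set.Finite.mem_toFinset] at this
  have hsib : ∀ x ∈ T, ∀ y ∈ T, x ≠ y → G.Adj x y ∧ G.Adj x p := fun x hx y hy hxy =>
    hR.siblings hw (by lia) (hT' x hx).1 (hT' y hy).1 (by rw [(hT' x hx).2, hn])
      (by rw [(hT' y hy).2, hn]) hxy hp.symm hpd
  have hpar : ∀ x ∈ T, G.Adj x p := fun x hx => by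
    obtain ⟨y, hy, hyx⟩ := Finset.exists_mem_ne (show 1 < T.card by lia) x
    exact (hsib x hx y hy hyx.symm).2
  have hwp : w ∉ insert p T := by
    rw [Finset.mem_insert, not_or]
    exact ⟨hp.ne', fun h => (hT' w h).1.ne rfl⟩
  have hpT : p ∉ T := fun h => (hpar p h).ne rfl
  refine hclique (insert w (insert p T)) ⟨?_, ?_⟩
  · rw [Finset.coe_insert, Finset.coe_insert]
    refine SimpleGraph.IsClique.insert (SimpleGraph.IsClique.insert ?_ ?_) ?_
    · exact fun x hx y hy hxy => (hsib x hx y hy hxy).1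
    · exact fun x hx _ => (hpar x hx).symm
    · rintro x (rfl | hx) _
      · exact hp.symm
      · exact (hT' x hx).1
  · rw [Finset.card_insert_of_notMem hwp, Finset.card_insert_of_notMem hpT, hTc]
    lia

/-- Every vertex has a child, since one parent and at most `k - 2` lateral neighbours do not exhaust
its degree. Two children of `w` have different children by uniqueness of parents. If `u` is the only
child, then `w` has a lateral neighbour; a lateral neighbour of `u` would have a parent other than
`w`, contrary to `no_lateral`. So `u` has `k - 1 ≥ 2` children. -/
theorem IsRigidBall.exists_grandchildren (hR : IsRigidBall G k r R) (hk : 3 ≤ k)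
    (hclique : G.CliqueFree (k + 1)) {w : V} {n : ℕ}
    (hw : G.Reachable r w) (hwR : n + 3 ≤ R) (hn : G.dist r w = n + 1) :
    ∃ z₁ z₂, z₁ ≠ z₂ ∧ (∃ u ∈ neighborsAt G r w (n + 2), z₁ ∈ neighborsAt G r u (n + 3)) ∧
      ∃ u ∈ neighborsAt G r w (n + 2), z₂ ∈ neighborsAt G r u (n + 3) := by
  have hchild : ∀ u m, m + 1 ≤ R → G.Reachable r u → G.dist r u = m + 1 →
      (neighborsAt G r u (m + 2)).Nonempty := fun u m hm hu hd => by
    have h1 := hR.card_neighbors hu hm hd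
    have h2 := hR.card_lateral hk hclique hu hm hd
    refine Set.nonempty_of_ncard_ne_zero ?_
    lia
  obtain ⟨u, hu⟩ := hchild w n (by lia) hw hn
  have hur := hw.trans hu.1.reachable
  by_cases hone : ∃ u' ∈ neighborsAt G r w (n + 2), u' ≠ u
  · obtain ⟨u', hu', hne⟩ := hone
    have hur' := hw.trans hu'.1.reachable
    obtain ⟨z, hz⟩ := hchild u (n + 1) (by lia) hur hu.2
    obtain ⟨z', hz'⟩ := hchild u' (n + 1) (by lia) hur' hu'.2
    refine ⟨z, z', ?_, ⟨u, hu, hz⟩, ⟨u', hu', hz'⟩⟩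
    rintro rfl
    exact hne (hR.parent_unique (hur'.trans hz'.1.reachable) (by rw [hz.2]; lia) hz'.1.symm
      hz.1.symm (by rw [hu'.2, hz'.2]) (by rw [hu.2, hz.2]))
  · push Not at hone
    have h1 : (neighborsAt G r w (n + 2)).ncard = 1 :=
      Set.ncard_eq_one.2 ⟨u, Set.eq_singleton_iff_unique_mem.2 ⟨hu, hone⟩⟩
    have h2 := hR.card_neighbors hw (by lia) hn
    obtain ⟨x, hx⟩ : (neighborsAt G r w (n + 1)).Nonempty :=
      Set.nonempty_of_ncard_ne_zero (by lia)
    have h3 : neighborsAt G r u (n + 2) = ∅ := by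
      rw [Set.eq_empty_iff_forall_notMem]
      intro z hz
      have hzr := hur.trans hz.1.reachable
      obtain ⟨z', hza, -, hzd⟩ := exists_adj_dist_succ hzr (by rw [hz.2]; lia)
      refine hR.no_lateral hur (by rw [hu.2]; lia) hz.1 (by rw [hz.2, hu.2]) hu.1.symm
        (by rw [hn, hu.2]) hza.symm hzd ?_ hx.1 (by rw [hx.2, hn])
      rintro rfl
      exact hz.1.ne (hone z ⟨hza, hz.2⟩).symm
    have h4 := hR.card_neighbors hur (show n + 1 + 1 ≤ R by lia) hu.2
    rw [show n + 1 + 1 = n + 2 by lia, h3, Set.ncard_empty] at h4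
    obtain ⟨z₁, hz₁, z₂, hz₂, hne⟩ := (Set.one_lt_ncard (hR.finite_neighborsAt _ _)).1
      (show 1 < (neighborsAt G r u (n + 1 + 2)).ncard by lia)
    exact ⟨z₁, z₂, hne, ⟨u, hu, hz₁⟩, ⟨u, hu, hz₂⟩⟩

/-- Grandparents are unique, so choosing two grandchildren for each vertex doubles the layer. The
layers are odd because the argument needs a parent and so starts at distance one. -/
theorem IsRigidBall.two_pow_le (hR : IsRigidBall G k r R) (hk : 3 ≤ k)
    (hclique : G.CliqueFree (k + 1))
    (hfin : ∀ n, {u | G.Reachable r u ∧ G.dist r u = n}.Finite) (j : ℕ) (hj : 2 * j + 1 ≤ R) :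
    2 ^ j ≤ {u | G.Reachable r u ∧ G.dist r u = 2 * j + 1}.ncard := by
  classical
  induction j with
  | zero =>
    refine (Set.ncard_pos (hfin _)).2 ?_
    have : (G.neighborSet r).Nonempty := by
      rw [← Set.encard_ne_zero, hR.degree_eq r (.refl r) (by simp)]
      simp; lia
    obtain ⟨u, hu⟩ := this
    exact ⟨u, SimpleGraph.Adj.reachable hu, by simpa using hu⟩
  | succ j ih =>
    choose! z₁ z₂ hne h₁ h₂ using fun (w : V)
      (hw : w ∈ {u | G.Reachable r u ∧ G.dist r u = 2 * j + 1}) =>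
      hR.exists_grandchildren hk hclique hw.1 (by lia) hw.2
    set S := {u | G.Reachable r u ∧ G.dist r u = 2 * j + 1}
    set S' := {u | G.Reachable r u ∧ G.dist r u = 2 * (j + 1) + 1}
    have hmem : ∀ w ∈ S, ∀ z, (∃ u ∈ neighborsAt G r w (2 * j + 2),
        z ∈ neighborsAt G r u (2 * j + 3)) → z ∈ S' := by
      rintro w hw z ⟨u, hu, hz⟩
      exact ⟨(hw.1.trans hu.1.reachable).trans hz.1.reachable, by rw [hz.2]; ring⟩
    have huniq : ∀ w ∈ S, ∀ w' ∈ S, ∀ z, (∃ u ∈ neighborsAt G r w (2 * j + 2),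
        z ∈ neighborsAt G r u (2 * j + 3)) → (∃ u ∈ neighborsAt G r w' (2 * j + 2),
        z ∈ neighborsAt G r u (2 * j + 3)) → w = w' := by
      rintro w hw w' hw' z ⟨u, hu, hz⟩ ⟨u', hu', hz'⟩
      have hur := hw.1.trans hu.1.reachable
      have : u = u' := hR.parent_unique (hur.trans hz.1.reachable) (by rw [hz.2]; lia)
        hz.1.symm hz'.1.symm (by rw [hu.2, hz.2]) (by rw [hu'.2, hz.2])
      subst this
      exact hR.parent_unique hur (by rw [hu.2]; lia) hu.1.symm hu'.1.symm (by rw [hw.2, hu.2])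
        (by rw [hw'.2, hu.2])
    have hinj₁ : Set.InjOn z₁ S := fun w hw w' hw' h =>
      huniq w hw w' hw' _ (h₁ w hw) (h ▸ h₁ w' hw')
    have hinj₂ : Set.InjOn z₂ S := fun w hw w' hw' h =>
      huniq w hw w' hw' _ (h₂ w hw) (h ▸ h₂ w' hw')
    have hdisj : Disjoint (z₁ '' S) (z₂ '' S) := by
      rw [Set.disjoint_left]
      rintro _ ⟨w, hw, rfl⟩ ⟨w', hw', h⟩
      have := huniq w hw w' hw' _ (h₁ w hw) (h ▸ h₂ w' hw')
      subst this
      exact hne w hw h.symm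
    have hsub : z₁ '' S ∪ z₂ '' S ⊆ S' := by
      rintro _ (⟨w, hw, rfl⟩ | ⟨w, hw, rfl⟩)
      exacts [hmem w hw _ (h₁ w hw), hmem w hw _ (h₂ w hw)]
    have hS : S.Finite := hfin _
    have := Set.ncard_le_ncard hsub (hfin _)
    rw [Set.ncard_union_eq hdisj (hS.image _) (hS.image _), hinj₁.ncard_image,
      hinj₂.ncard_image] at this
    have := ih (by lia)
    rw [pow_succ]
    lia

end Growth

/-! ### Extendability of balls -/

section ExtendableBall

variable {V : Type*} {G : SimpleGraph V} {k : ℕ}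

theorem mem_closedBall_iff {v u : V} {R : ℕ} :
    u ∈ closedBall G v R ↔ G.Reachable v u ∧ G.dist v u ≤ R := by
  change G.edist v u ≤ R ↔ _
  constructor
  · intro h
    have hr : G.Reachable v u :=
      SimpleGraph.reachable_of_edist_ne_top (ne_top_of_le_ne_top (ENat.natCast_ne_top R) h)
    rw [← hr.coe_dist_eq_edist] at h
    exact ⟨hr, by exact_mod_cast h⟩
  · rintro ⟨hr, h⟩
    rw [← hr.coe_dist_eq_edist]
    exact_mod_cast h

/-- A maximal extendable subset of the ball absorbs every adjacent vertex of the ball. Following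
parents it reaches the centre, and from there, outwards, the whole ball. -/
theorem IsExtendable.closedBall_of_subset (hdeg : ∀ v, (G.neighborSet v).encard ≤ k) {z : V} {R : ℕ}
    (hfin : (closedBall G z R).Finite) {H : Set V} (hne : H.Nonempty) (hHB : H ⊆ closedBall G z R)
    (hH : IsExtendable G k H) : IsExtendable G k (closedBall G z R) := by
  have hfam : {A | A ⊆ closedBall G z R ∧ IsExtendable G k A}.Finite :=
    hfin.finite_subsets.subset fun A hA => hA.1
  obtain ⟨A, hHA, hA⟩ := hfam.exists_le_maximal (a := H) ⟨hHB, hH⟩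
  have hstep : ∀ u ∈ A, ∀ v ∈ closedBall G z R, G.Adj v u → v ∈ A := by
    intro u hu v hv hvu
    have : insert v A ≤ A := hA.2 ⟨Set.insert_subset hv hA.1.1, hA.1.2.insert_of_adj (hdeg v) hu hvu⟩
      (Set.subset_insert v A)
    exact this (Set.mem_insert v A)
  have hroot : ∀ n, ∀ u ∈ A, G.dist z u = n → z ∈ A := by
    intro n
    induction n with
    | zero =>
      intro u hu h
      have := (mem_closedBall_iff.1 (hA.1.1 hu)).1.dist_eq_zero_iff.1 h
      rwa [this]
    | succ n ih =>
      intro u hu h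
      obtain ⟨hr, hd⟩ := mem_closedBall_iff.1 (hA.1.1 hu)
      obtain ⟨p, hpu, hpr, hpd⟩ := exists_adj_dist_succ hr (by lia)
      exact ih p (hstep u hu p (mem_closedBall_iff.2 ⟨hpr, by lia⟩) hpu) (by lia)
  have hz : z ∈ A := by
    obtain ⟨u, hu⟩ := hne
    exact hroot _ u (hHA hu) rfl
  have hall : ∀ n ≤ R, ∀ u, G.Reachable z u → G.dist z u = n → u ∈ A := by
    intro n
    induction n with
    | zero =>
      intro _ u hr h
      rwa [← hr.dist_eq_zero_iff.1 h]
    | succ n ih =>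
      intro hn u hr h
      obtain ⟨p, hpu, hpr, hpd⟩ := exists_adj_dist_succ hr (by lia)
      exact hstep p (ih (by lia) p hpr (by lia)) u (mem_closedBall_iff.2 ⟨hr, by lia⟩) hpu.symm
  have : A = closedBall G z R :=
    hA.1.1.antisymm fun u hu => by
      obtain ⟨hr, hd⟩ := mem_closedBall_iff.1 hu
      exact hall _ hd u hr rfl
  rw [← this]
  exact hA.1.2

theorem IsSubexponential.exists_le_two_pow {f : ℕ → ℕ} (hf : IsSubexponential f) :
    ∃ j, f (2 * j + 1) ≤ 2 ^ j := by
  -- The choice `ε = 2/5` works because `(7/5)^2 < 2`; the factor `1/2` absorbs the odd power, as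
  -- `(1/2) * (7/5) < 1`.
  have h := (hf (2 / 5) (by norm_num)).bound (show (0 : ℝ) < 1 / 2 by norm_num)
  obtain ⟨N, hN⟩ := Filter.eventually_atTop.1 h
  refine ⟨N, ?_⟩
  have h1 := hN (2 * N + 1) (by lia)
  rw [Real.norm_of_nonneg (by positivity), Real.norm_of_nonneg (by positivity), pow_succ,
    pow_mul] at h1
  have h2 : ((1 + 2 / 5 : ℝ) ^ 2) ^ N ≤ 2 ^ N := pow_le_pow_left₀ (by norm_num) (by norm_num) N
  have h3 : (0 : ℝ) < 2 ^ N := by positivity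
  have : (f (2 * N + 1) : ℝ) ≤ 2 ^ N := by nlinarith
  exact_mod_cast this

theorem BoundsGrowth.finite_closedBall {f : ℕ → ℕ} (hf : BoundsGrowth f G) (v : V) (R : ℕ) :
    (closedBall G v R).Finite :=
  Set.finite_of_encard_le_coe (hf v R).le

/-- In a graph of subexponential growth without large cliques, balls of a suitable fixed radius
are extendable. -/
theorem exists_extendable_closedBall (hgrowth : HasSubexponentialGrowth G) (hk : 3 ≤ k)
    (hdeg : ∀ v, (G.neighborSet v).encard ≤ k) (hclique : G.CliqueFree (k + 1)) :
    ∃ R, ∀ z, IsExtendable G k (closedBall G z R) := by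
  obtain ⟨f, hf, hfG⟩ := hgrowth
  obtain ⟨j, hj⟩ := hf.exists_le_two_pow
  refine ⟨2 * j + 1, fun z => ?_⟩
  have hfin := hfG.finite_closedBall
  by_contra hno
  have hR : IsRigidBall G k z (2 * j + 1) := by
    refine ⟨hdeg, fun u hu hd => ?_, fun H hne hH hext => ?_⟩
    · by_contra h
      exact hno (IsExtendable.closedBall_of_subset hdeg (hfin _ _) (Set.singleton_nonempty u)
        (Set.singleton_subset_iff.2 (mem_closedBall_iff.2 ⟨hu, hd⟩))
        (isExtendable_singleton (lt_of_le_of_ne (hdeg u) h)))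
    · exact hno (hext.closedBall_of_subset hdeg (hfin _ _) hne fun u hu => mem_closedBall_iff.2 (hH u hu))
  have hsub : ∀ n, {u | G.Reachable z u ∧ G.dist z u = n} ⊆ closedBall G z n := fun n u hu =>
    mem_closedBall_iff.2 ⟨hu.1, hu.2.le⟩
  have h1 := hR.two_pow_le hk hclique (fun n => (hfin z n).subset (hsub n)) j le_rfl
  have h2 := Set.ncard_le_ncard (hsub (2 * j + 1)) (hfin z _)
  have h3 := hfG z (2 * j + 1)
  rw [← (hfin z _).cast_ncard_eq] at h3
  have h4 : (closedBall G z (2 * j + 1)).ncard < f (2 * j + 1) := by exact_mod_cast h3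
  lia

end ExtendableBall

/-! ### Projections with bounded sections -/

section Projection

/-- The projection of a Borel set whose sections have boundedly many elements is Borel. -/
theorem measurableSet_image_fst_of_encard_le {X Y : Type*} [MeasurableSpace X]
    [StandardBorelSpace X] [MeasurableSpace Y] [StandardBorelSpace Y] (k : ℕ) :
    ∀ A : Set (X × Y), MeasurableSet A → (∀ x, {y | (x, y) ∈ A}.encard ≤ k) →
      MeasurableSet (Prod.fst '' A) := by
  classical
  induction k with
  | zero =>
    intro A _ h
    have : A = ∅ := by
      rw [Set.eq_empty_iff_forall_notMem]
      rintro ⟨x, y⟩ hxy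
      have h0 : {y | (x, y) ∈ A} = ∅ := by
        rw [← Set.encard_eq_zero]
        simpa using h x
      have : y ∈ {y | (x, y) ∈ A} := hxy
      rw [h0] at this
      exact this
    simp [this]
  | succ k ih =>
    intro A hA h
    obtain ⟨e, he⟩ := MeasureTheory.exists_measurableEmbedding_real Y
    -- `B` consists of the increasing enumerations of the sections with exactly `k + 1` points, in
    -- the order pulled back from `ℝ`. Such an enumeration is unique, so `B` projects injectively
    -- and its image is Borel by Lusin–Souslin; the remaining sections have at most `k` points.
    set B : Set (X × (Fin (k + 1) → Y)) :=
      {p | StrictMono (fun i => e (p.2 i)) ∧ ∀ i, (p.1, p.2 i) ∈ A} with hB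
    have hBm : MeasurableSet B := by
      have : B = (⋂ i, ⋂ j, {p | i < j → e (p.2 i) < e (p.2 j)}) ∩
          ⋂ i, {p | (p.1, p.2 i) ∈ A} := by
        ext p
        simp only [hB, StrictMono, Set.mem_inter_iff, Set.mem_iInter]
        rfl
      rw [this]
      have hcoord : ∀ i, Measurable fun p : X × (Fin (k + 1) → Y) => p.2 i := fun i =>
        (measurable_pi_apply i).comp measurable_snd
      refine MeasurableSet.inter (MeasurableSet.iInter fun i => MeasurableSet.iInter fun j => ?_)
        (MeasurableSet.iInter fun i => (measurable_fst.prodMk (hcoord i)) hA)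
      by_cases hij : i < j
      · simp only [hij, true_imp_iff]
        exact measurableSet_lt (he.measurable.comp (hcoord i)) (he.measurable.comp (hcoord j))
      · simp [hij]
    have hrange : ∀ p ∈ B, Set.range p.2 = {y | (p.1, y) ∈ A} := by
      rintro ⟨x, y⟩ ⟨hmono, hmem⟩
      have hinj : Function.Injective y := Function.Injective.of_comp (f := e) hmono.injective
      refine (Set.finite_of_encard_le_coe (h x)).eq_of_subset_of_encard_le'
        (Set.range_subset_iff.2 hmem) ?_
      rw [encard_range_fin hinj]
      exact h x
    have hinj : Set.InjOn Prod.fst B := by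
      rintro ⟨x, y⟩ hp ⟨x', y'⟩ hp' (rfl : x = x')
      have h1 := (hrange _ hp).trans (hrange _ hp').symm
      have h2 : (fun i => e (y i)) = fun i => e (y' i) := by
        refine (StrictMono.range_inj hp.1 hp'.1).1 ?_
        have := congrArg (fun s => e '' s) h1
        simp only [← Set.range_comp] at this
        exact this
      have h3 : y = y' := funext fun i => he.injective (congrFun h2 i)
      rw [h3]
    have hD : MeasurableSet (Prod.fst '' B) := hBm.image_of_measurable_injOn measurable_fst hinj
    have hsplit : Prod.fst '' A =
        Prod.fst '' B ∪ Prod.fst '' (A ∩ Prod.fst ⁻¹' (Prod.fst '' B)ᶜ) := by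
      ext x
      constructor
      · rintro ⟨p, hp, rfl⟩
        by_cases hx : p.1 ∈ Prod.fst '' B
        · exact Or.inl hx
        · exact Or.inr ⟨p, ⟨hp, hx⟩, rfl⟩
      · rintro (⟨p, hp, rfl⟩ | ⟨p, hp, rfl⟩)
        · exact ⟨_, hp.2 0, rfl⟩
        · exact ⟨p, hp.1, rfl⟩
    rw [hsplit]
    refine hD.union (ih _ (hA.inter (measurable_fst hD.compl)) fun x => ?_)
    by_cases hx : x ∈ Prod.fst '' B
    · have : {y | (x, y) ∈ A ∩ Prod.fst ⁻¹' (Prod.fst '' B)ᶜ} = ∅ := by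
        rw [Set.eq_empty_iff_forall_notMem]
        rintro y ⟨_, hy⟩
        exact hy hx
      rw [this]
      simp
    · refine (Set.encard_le_encard (t := {y | (x, y) ∈ A}) fun y hy => hy.1).trans ?_
      by_contra hlt
      have hfin : {y | (x, y) ∈ A}.Finite := Set.finite_of_encard_le_coe (h x)
      have hcard : {y | (x, y) ∈ A}.ncard = k + 1 := by
        have h1 := h x
        rw [← hfin.cast_ncard_eq] at h1 hlt
        have h1' : {y | (x, y) ∈ A}.ncard ≤ k + 1 := by exact_mod_cast h1
        have h2' : ¬ {y | (x, y) ∈ A}.ncard ≤ k := by exact_mod_cast hlt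
        lia
      have hcard' : ((hfin.image e).toFinset).card = k + 1 := by
        rw [← Set.ncard_eq_toFinset_card _ (hfin.image e), Set.ncard_image_of_injective _ he.injective, hcard]
      set o := (hfin.image e).toFinset.orderEmbOfFin hcard' with ho
      have hmem : ∀ i, ∃ y, (x, y) ∈ A ∧ e y = o i := fun i => by
        have := Finset.orderEmbOfFin_mem (hfin.image e).toFinset hcard' i
        rw [Set.Finite.mem_toFinset] at this
        exact this
      choose y hyA hye using hmem
      exact hx ⟨(x, y), ⟨by simpa only [hye] using o.strictMono, hyA⟩, rfl⟩

end Projection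

/-! ### Borel neighbourhoods, thickenings and power graphs -/

section Neighborhoods

variable {V : Type*}

/-- The set of vertices with a neighbour in `A`. -/
def nbhd (G : SimpleGraph V) (A : Set V) : Set V :=
  {v | ∃ w ∈ A, G.Adj v w}

/-- The set of vertices at distance at most `n` from `A`. -/
def thickening (G : SimpleGraph V) (A : Set V) (n : ℕ) : Set V :=
  {v | ∃ w ∈ A, G.edist v w ≤ n}

/-- Neighbourhoods of Borel sets are Borel. -/
def HasBorelNbhds [MeasurableSpace V] (G : SimpleGraph V) : Prop :=
  ∀ A : Set V, MeasurableSet A → MeasurableSet (nbhd G A)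

/-- The graph joining distinct vertices at distance at most `n`. -/
def powerGraph (G : SimpleGraph V) (n : ℕ) : SimpleGraph V where
  Adj v w := v ≠ w ∧ G.edist v w ≤ n
  symm := ⟨fun v w h => ⟨h.1.symm, by rw [SimpleGraph.edist_comm]; exact h.2⟩⟩
  loopless := ⟨fun _ h => h.1 rfl⟩

theorem IsBorelGraph.hasBorelNbhds [MeasurableSpace V] [StandardBorelSpace V]
    {G : SimpleGraph V} (hG : IsBorelGraph G) {k : ℕ}
    (hdeg : ∀ v, (G.neighborSet v).encard ≤ k) : HasBorelNbhds G := by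
  intro A hA
  have hE : MeasurableSet {p : V × V | G.Adj p.1 p.2} :=
    (measurable_quot_mk : Measurable (Quot.mk (Sym2.Rel V))) hG
  have heq : nbhd G A = Prod.fst '' ({p : V × V | G.Adj p.1 p.2} ∩ Prod.snd ⁻¹' A) := by
    ext v
    constructor
    · rintro ⟨w, hw, h⟩
      exact ⟨(v, w), ⟨h, hw⟩, rfl⟩
    · rintro ⟨⟨v, w⟩, ⟨h, hw⟩, rfl⟩
      exact ⟨w, hw, h⟩
  rw [heq]
  refine measurableSet_image_fst_of_encard_le k _ (hE.inter (measurable_snd hA)) fun v => ?_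
  exact (Set.encard_le_encard fun w hw => hw.1).trans (hdeg v)

theorem thickening_zero (G : SimpleGraph V) (A : Set V) : thickening G A 0 = A := by
  ext v
  simp [thickening]

theorem thickening_succ (G : SimpleGraph V) (A : Set V) (n : ℕ) :
    thickening G A (n + 1) = thickening G A n ∪ nbhd G (thickening G A n) := by
  ext v
  constructor
  · rintro ⟨w, hw, h⟩
    obtain ⟨p, hp⟩ := SimpleGraph.exists_walk_of_edist_ne_top
      (ne_top_of_le_ne_top (ENat.natCast_ne_top (n + 1)) h)
    rw [← hp] at h
    have hlen : p.length ≤ n + 1 := by exact_mod_cast h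
    cases p with
    | nil => exact Or.inl ⟨v, hw, by simp⟩
    | cons hadj q =>
      refine Or.inr ⟨_, ⟨w, hw, (G.edist_le q).trans ?_⟩, hadj⟩
      rw [SimpleGraph.Walk.length_cons] at hlen
      exact_mod_cast (show q.length ≤ n by lia)
  · rintro (⟨w, hw, h⟩ | ⟨u, ⟨w, hw, h⟩, hadj⟩)
    · exact ⟨w, hw, h.trans (by exact_mod_cast Nat.le_succ n)⟩
    · refine ⟨w, hw, (SimpleGraph.edist_triangle (v := u)).trans ?_⟩
      rw [SimpleGraph.edist_eq_one_iff_adj.2 hadj, add_comm]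
      push_cast
      gcongr

theorem HasBorelNbhds.measurableSet_thickening [MeasurableSpace V] {G : SimpleGraph V} (hG : HasBorelNbhds G)
    {A : Set V} (hA : MeasurableSet A) (n : ℕ) : MeasurableSet (thickening G A n) := by
  induction n with
  | zero => rwa [thickening_zero]
  | succ n ih =>
    rw [thickening_succ]
    exact ih.union (hG _ ih)

/-- A thickening does not exclude `v` itself as its witness. Distinct vertices are therefore
separated by a rational between their real images, which leaves a countable union of Borel pieces.
-/
theorem HasBorelNbhds.hasBorelNbhds_powerGraph [MeasurableSpace V] [StandardBorelSpace V]
    {G : SimpleGraph V} (hG : HasBorelNbhds G) (n : ℕ) : HasBorelNbhds (powerGraph G n) := by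
  intro A hA
  obtain ⟨e, he⟩ := MeasureTheory.exists_measurableEmbedding_real V
  have hlt : ∀ q : ℚ, MeasurableSet (e ⁻¹' Set.Iio (q : ℝ)) := fun q =>
    he.measurable measurableSet_Iio
  have hgt : ∀ q : ℚ, MeasurableSet (e ⁻¹' Set.Ioi (q : ℝ)) := fun q =>
    he.measurable measurableSet_Ioi
  have heq : nbhd (powerGraph G n) A =
      ⋃ q : ℚ, (e ⁻¹' Set.Iio (q : ℝ) ∩
          thickening G (A ∩ e ⁻¹' Set.Ioi (q : ℝ)) n) ∪
        (e ⁻¹' Set.Ioi (q : ℝ) ∩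
          thickening G (A ∩ e ⁻¹' Set.Iio (q : ℝ)) n) := by
    ext v
    simp only [Set.mem_iUnion]
    constructor
    · rintro ⟨w, hw, hne, hd⟩
      rcases lt_or_gt_of_ne (he.injective.ne hne) with h | h
      · obtain ⟨q, h1, h2⟩ := exists_rat_btwn h
        exact ⟨q, Or.inl ⟨h1, w, ⟨hw, h2⟩, hd⟩⟩
      · obtain ⟨q, h1, h2⟩ := exists_rat_btwn h
        exact ⟨q, Or.inr ⟨h2, w, ⟨hw, h1⟩, hd⟩⟩
    · rintro ⟨q, ⟨hv, w, ⟨hw, hwq⟩, hd⟩ | ⟨hv, w, ⟨hw, hwq⟩, hd⟩⟩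
      · refine ⟨w, hw, ?_, hd⟩
        rintro rfl
        exact lt_asymm (Set.mem_preimage.1 hv) (Set.mem_preimage.1 hwq)
      · refine ⟨w, hw, ?_, hd⟩
        rintro rfl
        exact lt_asymm (Set.mem_preimage.1 hv) (Set.mem_preimage.1 hwq)
  rw [heq]
  exact MeasurableSet.iUnion fun q =>
    ((hlt q).inter (hG.measurableSet_thickening (hA.inter (hgt q)) n)).union
      ((hgt q).inter (hG.measurableSet_thickening (hA.inter (hlt q)) n))

end Neighborhoods

/-! ### Borel greedy colourings -/

section Greedy

variable {V : Type*}

/-- The finitely many neighbours of `v` avoid some rational interval around the real image of `v`.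
The index of the first such interval is the colour; a neighbour with the same index would lie in
that interval. -/
theorem HasBorelNbhds.exists_countable_coloring [MeasurableSpace V] [StandardBorelSpace V]
    {G : SimpleGraph V} (hG : HasBorelNbhds G) (hfin : ∀ v, (G.neighborSet v).Finite) :
    ∃ ψ : V → ℕ, Measurable ψ ∧ ∀ v w, G.Adj v w → ψ v ≠ ψ w := by
  classical
  obtain ⟨e, he⟩ := MeasureTheory.exists_measurableEmbedding_real V
  obtain ⟨F, hF⟩ := exists_surjective_nat (ℚ × ℚ)
  set U : ℕ → Set V := fun n => e ⁻¹' Set.Ioo ((F n).1 : ℝ) ((F n).2 : ℝ)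
  have hU : ∀ n, MeasurableSet (U n) := fun n => he.measurable measurableSet_Ioo
  have hex : ∀ v, ∃ n, v ∈ U n \ nbhd G (U n) := by
    intro v
    have hcl : IsClosed (e '' G.neighborSet v) := ((hfin v).image e).isClosed
    have hv : e v ∈ (e '' G.neighborSet v)ᶜ := by
      rintro ⟨w, hw, hwv⟩
      exact G.ne_of_adj hw (he.injective hwv).symm
    obtain ⟨l, u, ⟨hl, hu⟩, hsub⟩ :=
      mem_nhds_iff_exists_Ioo_subset.1 (hcl.isOpen_compl.mem_nhds hv)
    obtain ⟨p, hp1, hp2⟩ := exists_rat_btwn hl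
    obtain ⟨q, hq1, hq2⟩ := exists_rat_btwn hu
    obtain ⟨n, hn⟩ := hF (p, q)
    refine ⟨n, ?_, ?_⟩
    · change e v ∈ Set.Ioo _ _
      rw [hn]
      exact ⟨hp2, hq1⟩
    · rintro ⟨w, hw, hadj⟩
      change e w ∈ Set.Ioo _ _ at hw
      rw [hn] at hw
      exact hsub ⟨hp1.trans hw.1, hw.2.trans hq2⟩ ⟨w, hadj, rfl⟩
  refine ⟨fun v => Nat.find (hex v), measurable_find hex fun n => (hU n).diff (hG _ (hU n)), ?_⟩
  intro v w hadj heq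
  have h1 := (Nat.find_spec (hex v)).2
  have h2 := (Nat.find_spec (hex w)).1
  simp only at heq
  rw [← heq] at h2
  exact h1 ⟨w, h2, hadj⟩

/-- Colour the vertices in the order given by `ψ` with the least colour that is available. -/
noncomputable def greedyColor (G : SimpleGraph V) (ψ : V → ℕ) (v : V) : ℕ :=
  sInf {n | ∀ w, ∀ _ : ψ w < ψ v, G.Adj v w → greedyColor G ψ w ≠ n}
termination_by ψ v

theorem greedyColor_eq_iff {G : SimpleGraph V} (hfin : ∀ v, (G.neighborSet v).Finite) (ψ : V → ℕ)
    (v : V) (n : ℕ) : greedyColor G ψ v = n ↔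
      (∀ w, ψ w < ψ v → G.Adj v w → greedyColor G ψ w ≠ n) ∧
        ∀ m < n, ∃ w, ψ w < ψ v ∧ G.Adj v w ∧ greedyColor G ψ w = m := by
  set S := {n | ∀ w, ∀ _ : ψ w < ψ v, G.Adj v w → greedyColor G ψ w ≠ n} with hS
  have hne : S.Nonempty := by
    obtain ⟨n, hn⟩ := ((hfin v).image (greedyColor G ψ)).exists_notMem
    exact ⟨n, fun w _ hw h => hn ⟨w, hw, h⟩⟩
  have hdef : greedyColor G ψ v = sInf S := by rw [greedyColor]
  have hnot : ∀ m, m ∉ S ↔ ∃ w, ψ w < ψ v ∧ G.Adj v w ∧ greedyColor G ψ w = m := by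
    intro m
    simp only [hS, Set.mem_ofPred_eq]
    push Not
    rfl
  rw [hdef]
  constructor
  · rintro rfl
    exact ⟨Nat.sInf_mem hne, fun m hm => (hnot m).1 (Nat.notMem_of_lt_sInf hm)⟩
  · rintro ⟨h1, h2⟩
    refine le_antisymm (Nat.sInf_le h1) ?_
    by_contra hlt
    exact (hnot _).2 (h2 _ (not_le.1 hlt)) (Nat.sInf_mem hne)

/-- A Borel colouring with boundedly many colours such that each vertex is equal or adjacent to
a vertex of colour `0`. -/
theorem HasBorelNbhds.exists_greedy_coloring [MeasurableSpace V] [StandardBorelSpace V]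
    {G : SimpleGraph V} (hG : HasBorelNbhds G) {M : ℕ} (hdeg : ∀ v, (G.neighborSet v).encard < M) :
    ∃ κ : V → Fin M, (∀ l, MeasurableSet {v | κ v = l}) ∧ (∀ v w, G.Adj v w → κ v ≠ κ w) ∧
      ∀ v, (κ v : ℕ) ≠ 0 → ∃ w, G.Adj v w ∧ (κ w : ℕ) = 0 := by
  have hfin : ∀ v, (G.neighborSet v).Finite := fun v => Set.finite_of_encard_le_coe (hdeg v).le
  obtain ⟨ψ, hψ, hψG⟩ := hG.exists_countable_coloring hfin
  have hspec := fun v => (greedyColor_eq_iff hfin ψ v _).1 rfl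
  -- Each colour below that of `v` occurs on a neighbour, and these neighbours are distinct, so the
  -- colour is at most the degree.
  have hlt : ∀ v, greedyColor G ψ v < M := by
    intro v
    choose w hw using fun m : Fin (greedyColor G ψ v) => (hspec v).2 m m.2
    have hinj : Function.Injective w := fun a b hab => Fin.ext <| by
      rw [← (hw a).2.2, ← (hw b).2.2, hab]
    have h1 : (Set.range w).encard ≤ (G.neighborSet v).encard :=
      Set.encard_le_encard (by rintro _ ⟨a, rfl⟩; exact (hw a).2.1)
    rw [encard_range_fin hinj] at h1
    exact_mod_cast h1.trans_lt (hdeg v)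
  have hmeas : ∀ m n, MeasurableSet {v | ψ v = m ∧ greedyColor G ψ v = n} := by
    intro m
    induction m using Nat.strong_induction_on with
    | _ m ih =>
      intro n
      -- `A n` collects the vertices of colour `n` treated before stage `m`; the greedy rule at
      -- stage `m` only asks which of the sets `nbhd G (A n)` contain `v`.
      set A : ℕ → Set V := fun n => ⋃ m' : Fin m, {v | ψ v = m' ∧ greedyColor G ψ v = n} with hA
      have hAm : ∀ n, MeasurableSet (A n) := fun n => MeasurableSet.iUnion fun m' => ih m' m'.2 n
      have hmem : ∀ v n, v ∈ A n ↔ ψ v < m ∧ greedyColor G ψ v = n := by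
        intro v n
        simp only [hA, Set.mem_iUnion]
        exact ⟨fun ⟨m', h1, h2⟩ => ⟨h1 ▸ m'.2, h2⟩, fun ⟨h1, h2⟩ => ⟨⟨ψ v, h1⟩, rfl, h2⟩⟩
      have heq : {v | ψ v = m ∧ greedyColor G ψ v = n} =
          ψ ⁻¹' {m} ∩ ((nbhd G (A n))ᶜ ∩ ⋂ j : Fin n, nbhd G (A j)) := by
        ext v
        simp only [Set.mem_inter_iff, Set.mem_iInter, Set.mem_compl_iff]
        change (ψ v = m ∧ _) ↔ (ψ v = m ∧ _)
        refine and_congr_right fun hv => ?_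
        rw [greedyColor_eq_iff hfin]
        subst hv
        refine and_congr ?_ ?_
        · constructor
          · rintro h ⟨w, hw, hadj⟩
            exact h w ((hmem _ _).1 hw).1 hadj ((hmem _ _).1 hw).2
          · intro h w hw hadj hn
            exact h ⟨w, (hmem _ _).2 ⟨hw, hn⟩, hadj⟩
        · constructor
          · intro h j
            obtain ⟨w, h1, h2, h3⟩ := h j j.2
            exact ⟨w, (hmem _ _).2 ⟨h1, h3⟩, h2⟩
          · intro h j hj
            obtain ⟨w, h1, h2⟩ := h ⟨j, hj⟩
            exact ⟨w, ((hmem _ _).1 h1).1, h2, ((hmem _ _).1 h1).2⟩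
      rw [heq]
      exact (hψ (measurableSet_singleton m)).inter
        ((hG _ (hAm n)).compl.inter (MeasurableSet.iInter fun j => hG _ (hAm j)))
  refine ⟨fun v => ⟨greedyColor G ψ v, hlt v⟩, fun l => ?_, fun v w hadj h => ?_, fun v hv => ?_⟩
  · have : {v | (⟨greedyColor G ψ v, hlt v⟩ : Fin M) = l} =
        ⋃ m, {v | ψ v = m ∧ greedyColor G ψ v = l} := by
      ext v
      simp [Fin.ext_iff]
    rw [this]
    exact MeasurableSet.iUnion fun m => hmeas m l
  · have h' : greedyColor G ψ v = greedyColor G ψ w := congrArg Fin.val h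
    rcases lt_or_gt_of_ne (hψG v w hadj) with h1 | h1
    · exact (hspec w).1 v h1 hadj.symm h'
    · exact (hspec v).1 w h1 hadj h'.symm
  · obtain ⟨w, h1, h2, h3⟩ := (hspec v).2 0 (Nat.pos_of_ne_zero hv)
    exact ⟨w, h2, h3⟩

end Greedy

/-! ### From extendable balls to a Borel colouring -/

section BorelColoring

variable {V : Type*} [MeasurableSpace V] {G : SimpleGraph V} {k : ℕ}

/-- All vertices of `I` take their least free colour simultaneously; independence rules out
conflicts, and freeness is Borel as the complement of a neighbourhood. -/
theorem HasBorelNbhds.exists_color_independent (hG : HasBorelNbhds G) {c : V → Option (Fin k)}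
    (hc : IsPartialColoring G c) (hcm : ∀ a, MeasurableSet {v | c v = some a}) {I : Set V}
    (hI : MeasurableSet I) (hind : ∀ v ∈ I, ∀ w ∈ I, ¬ G.Adj v w)
    (hfree : ∀ v ∈ I, ∃ a, IsFree G c v a) :
    ∃ c' : V → Option (Fin k), IsPartialColoring G c' ∧
      (∀ a, MeasurableSet {v | c' v = some a}) ∧ (∀ v, v ∉ I → c' v = c v) ∧
        ∀ v ∈ I, c' v ≠ none := by
  classical
  have hleast : ∀ v, ∃ a : Option (Fin k), v ∈ I →
      ∃ b, a = some b ∧ IsFree G c v b ∧ ∀ d < b, ¬ IsFree G c v d := by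
    intro v
    by_cases hv : v ∈ I
    · have hwf := (inferInstance : WellFoundedLT (Fin k)).wf
      have hne : {a | IsFree G c v a}.Nonempty := hfree v hv
      exact ⟨some (hwf.min _ hne), fun _ => ⟨_, rfl, hwf.min_mem _ hne,
        fun d hd h => hwf.not_lt_min _ h hd⟩⟩
    · exact ⟨none, fun h => absurd h hv⟩
  choose φ hφ using hleast
  have hφ' : ∀ v ∈ I, ∀ a, φ v = some a ↔ IsFree G c v a ∧ ∀ d < a, ¬ IsFree G c v d := by
    intro v hv a
    obtain ⟨b, hb, hbf, hbl⟩ := hφ v hv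
    rw [hb, Option.some_inj]
    constructor
    · rintro rfl
      exact ⟨hbf, hbl⟩
    · rintro ⟨h1, h2⟩
      rcases lt_trichotomy a b with h | h | h
      exacts [absurd h1 (hbl a h), h.symm, absurd hbf (h2 b h)]
  have hfm : ∀ a, MeasurableSet {v | IsFree G c v a} := by
    intro a
    have : {v | IsFree G c v a} = (nbhd G {v | c v = some a})ᶜ := by
      ext v
      simp only [IsFree, nbhd, Set.mem_compl_iff, Set.mem_ofPred_eq]
      push Not
      exact forall_congr' fun w => ⟨fun h h1 h2 => h h2 h1, fun h h1 h2 => h h2 h1⟩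
    rw [this]
    exact (hG _ (hcm a)).compl
  set c' : V → Option (Fin k) := fun v => if v ∈ I then φ v else c v with hc'
  have hon : ∀ v ∈ I, c' v = φ v := fun v hv => if_pos hv
  have hoff : ∀ v, v ∉ I → c' v = c v := fun v hv => if_neg hv
  have hmix : ∀ v ∈ I, ∀ w, w ∉ I → G.Adj v w → ∀ a, c' v = some a → c' w ≠ some a := by
    intro v hv w hw hadj a ha
    rw [hon v hv, hφ' v hv] at ha
    rw [hoff w hw]
    exact ha.1 w hadj
  refine ⟨c', fun v w hadj a hv hw => ?_, fun a => ?_, hoff, fun v hv => ?_⟩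
  · by_cases h1 : v ∈ I
    · by_cases h2 : w ∈ I
      · exact hind v h1 w h2 hadj
      · exact hmix v h1 w h2 hadj a hv hw
    · by_cases h2 : w ∈ I
      · exact hmix w h2 v h1 hadj.symm a hw hv
      · rw [hoff v h1] at hv
        rw [hoff w h2] at hw
        exact hc v w hadj a hv hw
  · have : {v | c' v = some a} = (I ∩ ({v | IsFree G c v a} ∩
        ⋂ d : Fin k, ⋂ _ : d < a, {v | IsFree G c v d}ᶜ)) ∪ (Iᶜ ∩ {v | c v = some a}) := by
      ext v
      by_cases hv : v ∈ I
      · simp [hv, hon v hv, hφ' v hv]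
      · simp [hv, hoff v hv]
    rw [this]
    exact (hI.inter ((hfm a).inter (MeasurableSet.iInter fun d => MeasurableSet.iInter fun _ =>
      (hfm d).compl))).union (hI.compl.inter (hcm a))
  · obtain ⟨b, hb, -⟩ := hφ v hv
    rw [hon v hv, hb]
    simp

/-- The classes of `κ` are independent and are treated in turn. The uncoloured neighbour lies
outside `J`, so it stays uncoloured and keeps a colour free throughout. -/
theorem HasBorelNbhds.exists_color_layer (hG : HasBorelNbhds G)
    (hdeg : ∀ v, (G.neighborSet v).encard ≤ k) {M : ℕ} {κ : V → Fin M}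
    (hκm : ∀ l, MeasurableSet {v | κ v = l}) (hκ : ∀ v w, G.Adj v w → κ v ≠ κ w)
    {c : V → Option (Fin k)} (hc : IsPartialColoring G c)
    (hcm : ∀ a, MeasurableSet {v | c v = some a}) {J : Set V} (hJ : MeasurableSet J)
    (hnext : ∀ v ∈ J, ∃ u, G.Adj v u ∧ u ∉ J ∧ c u = none) :
    ∃ c' : V → Option (Fin k), IsPartialColoring G c' ∧
      (∀ a, MeasurableSet {v | c' v = some a}) ∧ (∀ v, v ∉ J → c' v = c v) ∧
        ∀ v ∈ J, c' v ≠ none := by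
  have key : ∀ m ≤ M, ∃ c' : V → Option (Fin k), IsPartialColoring G c' ∧
      (∀ a, MeasurableSet {v | c' v = some a}) ∧ (∀ v, v ∉ J → c' v = c v) ∧
        ∀ v ∈ J, (κ v : ℕ) < m → c' v ≠ none := by
    intro m
    induction m with
    | zero => exact fun _ => ⟨c, hc, hcm, fun _ _ => rfl, fun _ _ h => absurd h (by simp)⟩
    | succ m ih =>
      intro hm
      obtain ⟨c₁, h1, h2, h3, h4⟩ := ih (by lia)
      obtain ⟨c₂, h5, h6, h7, h8⟩ := hG.exists_color_independent h1 h2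
        (hJ.inter (hκm ⟨m, hm⟩))
        (fun v hv w hw hadj => hκ v w hadj (hv.2.trans hw.2.symm))
        (fun v hv => by
          obtain ⟨u, hvu, huJ, hu⟩ := hnext v hv.1
          exact exists_free (hdeg v) (Or.inl ⟨u, hvu, by rw [h3 u huJ, hu]⟩))
      refine ⟨c₂, h5, h6, fun v hv => ?_, fun v hv hvm => ?_⟩
      · rw [h7 v fun h => hv h.1, h3 v hv]
      · by_cases h : κ v = ⟨m, hm⟩
        · exact h8 v ⟨hv, h⟩
        · rw [h7 v fun h' => h h'.2]
          refine h4 v hv (lt_of_le_of_ne (by lia) fun h' => h (Fin.ext h'))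
  obtain ⟨c', h1, h2, h3, h4⟩ := key M le_rfl
  exact ⟨c', h1, h2, h3, fun v hv => h4 v hv (κ v).2⟩

/-- Start with nothing coloured and peel off the layers around `X` from the outermost inwards: a
vertex at distance `n + 1` from `X` has a neighbour at distance `n` that is not yet coloured. -/
theorem HasBorelNbhds.exists_color_compl (hG : HasBorelNbhds G)
    (hdeg : ∀ v, (G.neighborSet v).encard ≤ k) {M : ℕ} {κ : V → Fin M}
    (hκm : ∀ l, MeasurableSet {v | κ v = l}) (hκ : ∀ v w, G.Adj v w → κ v ≠ κ w)
    {X : Set V} (hX : MeasurableSet X) {D : ℕ} (hD : ∀ v, v ∈ thickening G X D) :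
    ∃ c : V → Option (Fin k), IsPartialColoring G c ∧
      (∀ a, MeasurableSet {v | c v = some a}) ∧ ∀ v, c v = none ↔ v ∈ X := by
  have key : ∀ n, (∃ c : V → Option (Fin k), IsPartialColoring G c ∧
      (∀ a, MeasurableSet {v | c v = some a}) ∧ ∀ v, c v = none ↔ v ∈ thickening G X n) →
      ∃ c : V → Option (Fin k), IsPartialColoring G c ∧
      (∀ a, MeasurableSet {v | c v = some a}) ∧ ∀ v, c v = none ↔ v ∈ X := by
    intro n
    induction n with
    | zero => rw [thickening_zero]; exact id
    | succ n ih =>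
      rintro ⟨c, hc, hcm, hcn⟩
      obtain ⟨c', h1, h2, h3, h4⟩ := hG.exists_color_layer hdeg hκm hκ hc hcm
        (J := thickening G X (n + 1) \ thickening G X n)
        ((hG.measurableSet_thickening hX _).diff (hG.measurableSet_thickening hX _)) (by
          rintro v ⟨hv, hvn⟩
          rw [thickening_succ] at hv
          rcases hv with hv | ⟨u, hu, hadj⟩
          · exact absurd hv hvn
          · refine ⟨u, hadj, fun h => h.2 hu, (hcn u).2 ?_⟩
            rw [thickening_succ]
            exact Or.inl hu)
      refine ih ⟨c', h1, h2, fun v => ⟨fun hv => ?_, fun hv => ?_⟩⟩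
      · by_contra hvn
        by_cases hvJ : v ∈ thickening G X (n + 1)
        · exact h4 v ⟨hvJ, hvn⟩ hv
        · rw [h3 v fun h => hvJ h.1] at hv
          exact hvJ ((hcn v).1 hv)
      · rw [h3 v fun h => h.2 hv, hcn, thickening_succ]
        exact Or.inl hv
  refine key D ⟨fun _ => none, fun v w _ a h => by simp at h, fun a => by simp, fun v => ?_⟩
  simp [hD v]

/-- A Borel graph is Borel `k`-colourable if its balls of some fixed radius are extendable. -/
theorem exists_isBorelColoring_of_isExtendable_closedBall [StandardBorelSpace V]
    (hG : HasBorelNbhds G) [NeZero k] (hdeg : ∀ v, (G.neighborSet v).encard ≤ k) {R M : ℕ}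
    (hball : ∀ v, (closedBall G v (2 * R + 1)).encard < M)
    (hext : ∀ z, IsExtendable G k (closedBall G z R)) :
    ∃ c : V → Fin k, IsBorelColoring G c := by
  classical
  -- The exponent `2 * R + 1` serves three purposes: `κ` is injective on `R`-balls, `R`-balls around
  -- distinct vertices of colour `0` are disjoint without edges between them, and every vertex is
  -- within `2 * R + 1` of colour `0`.
  obtain ⟨κ, hκm, hκ, hκ0⟩ := (hG.hasBorelNbhds_powerGraph (2 * R + 1)).exists_greedy_coloring (M := M)
    (fun v => (Set.encard_le_encard fun w hw => hw.2).trans_lt (hball v))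
  have hedist : ∀ {x y z : V} {m n : ℕ}, G.edist x y ≤ m → G.edist y z ≤ n →
      G.edist x z ≤ (m + n : ℕ) := fun h1 h2 =>
    SimpleGraph.edist_triangle.trans (by push_cast; exact add_le_add h1 h2)
  have hmono : ∀ {x y : V} {m n : ℕ}, m ≤ n → G.edist x y ≤ m → G.edist x y ≤ n := fun h h1 =>
    h1.trans (by exact_mod_cast h)
  have hadj1 : ∀ {x y : V}, G.Adj x y → G.edist x y ≤ (1 : ℕ) := fun h => by
    rw [SimpleGraph.edist_eq_one_iff_adj.2 h]; simp
  have hκ' : ∀ v w, G.edist v w ≤ (2 * R + 1 : ℕ) → κ v = κ w → v = w := fun v w h1 h2 => by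
    by_contra hne
    exact hκ v w ⟨hne, h1⟩ h2
  set Z : Set V := {v | (κ v : ℕ) = 0} with hZ
  have hZm : MeasurableSet Z := by
    have : Z = ⋃ l : Fin M, ⋃ _ : (l : ℕ) = 0, {v | κ v = l} := by
      ext v
      simp [hZ]
    rw [this]
    exact MeasurableSet.iUnion fun l => MeasurableSet.iUnion fun _ => hκm l
  have hZd : ∀ z ∈ Z, ∀ z' ∈ Z, G.edist z z' ≤ (2 * R + 1 : ℕ) → z = z' := fun z hz z' hz' h =>
    hκ' z z' h (Fin.ext (Eq.trans hz (Eq.symm hz')))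
  set X : Set V := thickening G Z R with hX
  have hXm : MeasurableSet X := hG.measurableSet_thickening hZm R
  have hZX : Z ⊆ X := fun z hz => ⟨z, hz, by simp⟩
  have hcover : ∀ v, v ∈ thickening G X (2 * R + 1) := by
    intro v
    by_cases hv : (κ v : ℕ) = 0
    · exact ⟨v, hZX hv, by simp⟩
    · obtain ⟨w, hw, hw0⟩ := hκ0 v hv
      exact ⟨w, hZX hw0, hw.2⟩
  obtain ⟨c, hc, hcm, hcn⟩ := hG.exists_color_compl hdeg hκm
    (fun v w h => hκ v w ⟨h.ne, hmono (by lia) (hadj1 h)⟩) hXm hcover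
  have hcomm : ∀ {x y : V} {n : ℕ}, G.edist x y ≤ n → G.edist y x ≤ n := fun h => by
    rwa [SimpleGraph.edist_comm]
  have hballX : ∀ z ∈ Z, closedBall G z R ⊆ X := fun z hz v hv => ⟨z, hz, hcomm hv⟩
  -- adjacent vertices of `X` lie in the same ball
  have hsame : ∀ z ∈ Z, ∀ v ∈ closedBall G z R, ∀ w ∈ X, G.Adj v w → w ∈ closedBall G z R := by
    rintro z hz v hv w ⟨z', hz', hw⟩ hadj
    have : z = z' := hZd z hz z' hz'
      (hmono (by lia) (hedist (hedist hv (hadj1 hadj)) hw))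
    subst this
    exact hcomm hw
  -- the colouring in which the vertices of `X` are coloured according to their labels
  set cg : (Fin M → Fin k) → V → Option (Fin k) := fun g w =>
    if w ∈ X then some (g (κ w)) else c w with hcg
  have hcgm : ∀ g a, MeasurableSet {w | cg g w = some a} := by
    intro g a
    have : {w | cg g w = some a} = (X ∩ ⋃ l : Fin M, ⋃ _ : g l = a, {v | κ v = l}) ∪
        (Xᶜ ∩ {w | c w = some a}) := by
      ext w
      by_cases hw : w ∈ X <;> simp [hcg, hw]
    rw [this]
    exact (hXm.inter (MeasurableSet.iUnion fun l => MeasurableSet.iUnion fun _ => hκm l)).union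
      (hXm.compl.inter (hcm a))
  -- `cg g` uses the pattern `g` on all of `X`, not only on the ball at `z`. This is harmless for
  -- centres, since neighbours of the ball that lie in `X` belong to the same ball (`hsame`).
  set good : (Fin M → Fin k) → Set V := fun g =>
    {z | ∀ v ∈ closedBall G z R, ∀ w, G.Adj v w → cg g w ≠ some (g (κ v))} with hgood
  have hgoodm : ∀ g, MeasurableSet (good g) := by
    intro g
    have hbad : MeasurableSet (⋃ l : Fin M, {v | κ v = l} ∩ nbhd G {w | cg g w = some (g l)}) :=
      MeasurableSet.iUnion fun l => (hκm l).inter (hG _ (hcgm g _))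
    have : good g = (thickening G
        (⋃ l : Fin M, {v | κ v = l} ∩ nbhd G {w | cg g w = some (g l)}) R)ᶜ := by
      ext z
      simp only [hgood, Set.mem_ofPred_eq, Set.mem_compl_iff]
      constructor
      · rintro h ⟨v, hv, hd⟩
        obtain ⟨l, rfl, w, hw, hadj⟩ := Set.mem_iUnion.1 hv
        exact h v hd w hadj hw
      · intro h v hv w hadj hw
        exact h ⟨v, Set.mem_iUnion.2 ⟨κ v, rfl, w, hw, hadj⟩, hv⟩
    rw [this]
    exact (hG.measurableSet_thickening hbad R).compl
  have hexg : ∀ z ∈ Z, ∃ g, z ∈ good g := by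
    intro z hz
    obtain ⟨c', hc', hoff, hon⟩ := hext z c hc fun v hv => (hcn v).2 (hballX z hz hv)
    have hlab : ∀ l : Fin M, ∃ a : Fin k, ∀ v ∈ closedBall G z R, κ v = l → c' v = some a := by
      intro l
      by_cases h : ∃ v ∈ closedBall G z R, κ v = l
      · obtain ⟨v, hv, rfl⟩ := h
        obtain ⟨a, ha⟩ := Option.ne_none_iff_exists'.1 (hon v hv)
        refine ⟨a, fun w hw hwv => ?_⟩
        rw [hκ' w v (hmono (by lia) (hedist (hcomm hw) hv)) hwv, ha]
      -- Labels not present in the ball may be given any colour.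
      · exact ⟨0, fun v hv hvl => absurd ⟨v, hv, hvl⟩ h⟩
    choose g hg using hlab
    refine ⟨g, fun v hv w hadj hw => ?_⟩
    have hv' := hg _ v hv rfl
    by_cases hwX : w ∈ X
    · have hwB := hsame z hz v hv w hwX hadj
      refine hc' v w hadj _ hv' ?_
      rw [hg _ w hwB rfl]
      simpa [hcg, hwX] using hw
    · refine hc' v w hadj _ hv' ?_
      rw [hoff w fun h => hwX (hballX z hz h)]
      simpa [hcg, hwX] using hw
  obtain ⟨F, hF⟩ := exists_surjective_nat (Fin M → Fin k)
  -- Adding `Zᶜ` makes the search succeed at every vertex, so the first index is a measurable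
  -- function on all of `V`.
  have hexn : ∀ z, ∃ n, z ∈ Zᶜ ∪ good (F n) := by
    intro z
    by_cases hz : z ∈ Z
    · obtain ⟨g, hg⟩ := hexg z hz
      obtain ⟨n, rfl⟩ := hF g
      exact ⟨n, Or.inr hg⟩
    · exact ⟨0, Or.inl hz⟩
  set γ : V → ℕ := fun z => Nat.find (hexn z) with hγ
  have hγm : Measurable γ := measurable_find hexn fun n => hZm.compl.union (hgoodm _)
  have hγg : ∀ z ∈ Z, z ∈ good (F (γ z)) := fun z hz =>
    (Nat.find_spec (hexn z)).resolve_left fun h => h hz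
  -- The chosen centre is the only one within `R` of `v`, so the choice does not threaten
  -- measurability; the default `0` never occurs, as `c` is defined off `X`.
  set d : V → Fin k := fun v =>
    if h : v ∈ X then F (γ h.choose) (κ v) else (c v).getD 0 with hd
  have hdX : ∀ z ∈ Z, ∀ v ∈ closedBall G z R, d v = F (γ z) (κ v) := by
    intro z hz v hv
    have h : v ∈ X := hballX z hz hv
    have : h.choose = z := hZd _ h.choose_spec.1 z hz
      (hmono (by lia) (hedist (hcomm h.choose_spec.2) (hcomm hv)))
    simp only [hd]
    rw [dif_pos h, this]
  have hdoff : ∀ v, v ∉ X → c v = some (d v) := by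
    intro v hv
    obtain ⟨a, ha⟩ := Option.ne_none_iff_exists'.1 (fun h => hv ((hcn v).1 h))
    simp [hd, hv, ha]
  have hproper : ∀ v ∈ X, ∀ w, G.Adj v w → d v ≠ d w := by
    rintro v ⟨z, hz, hv⟩ w hadj heq
    have hvB : v ∈ closedBall G z R := hcomm hv
    refine hγg z hz v hvB w hadj ?_
    rw [← hdX z hz v hvB, heq]
    by_cases hw : w ∈ X
    · rw [hdX z hz w (hsame z hz v hvB w hw hadj)]
      simp [hcg, hw]
    · rw [← hdoff w hw]
      simp [hcg, hw]
  refine ⟨d, fun v w hadj heq => ?_, fun i => ?_⟩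
  · by_cases hv : v ∈ X
    · exact hproper v hv w hadj heq
    · by_cases hw : w ∈ X
      · exact hproper w hw v hadj.symm heq.symm
      · exact hc v w hadj (d v) (hdoff v hv) (by rw [heq]; exact hdoff w hw)
  · have : d ⁻¹' {i} = (⋃ n, thickening G (Z ∩ γ ⁻¹' {n}) R ∩
        ⋃ l : Fin M, ⋃ _ : F n l = i, {v | κ v = l}) ∪ (Xᶜ ∩ {v | c v = some i}) := by
      ext v
      simp only [Set.mem_preimage, Set.mem_singleton_iff, Set.mem_union, Set.mem_iUnion,
        Set.mem_inter_iff, Set.mem_compl_iff, Set.mem_ofPred_eq]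
      constructor
      · intro hv
        by_cases hvX : v ∈ X
        · obtain ⟨z, hz, hvz⟩ := hvX
          refine Or.inl ⟨γ z, ⟨z, ⟨hz, rfl⟩, hvz⟩, κ v, ?_, rfl⟩
          rw [← hdX z hz v (hcomm hvz), hv]
        · exact Or.inr ⟨hvX, by rw [hdoff v hvX, hv]⟩
      · rintro (⟨n, ⟨z, ⟨hz, hzn⟩, hvz⟩, l, hl, hvl⟩ | ⟨hvX, hv⟩)
        · rw [hdX z hz v (hcomm hvz), hvl, ← hl]
          rw [show γ z = n from hzn]
        · rw [hdoff v hvX] at hv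
          exact Option.some_injective _ hv
    rw [this]
    refine (MeasurableSet.iUnion fun n => (hG.measurableSet_thickening
      (hZm.inter (hγm (measurableSet_singleton n))) R).inter ?_).union (hXm.compl.inter (hcm i))
    exact MeasurableSet.iUnion fun l => MeasurableSet.iUnion fun _ => hκm l

end BorelColoring

end BorelCombinatorics

/-! ### The Brooks bound -/

theorem theoremt {V : Type*} [MeasurableSpace V] [StandardBorelSpace V]
    (G : SimpleGraph V) (hG : BorelCombinatorics.IsBorelGraph G)
    (hgrowth : BorelCombinatorics.HasSubexponentialGrowth G)
    (Δ : ℕ) (hΔ : BorelCombinatorics.maxDegree G = (Δ : ℕ∞)) (hΔ3 : 3 ≤ Δ)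
    (hclique : G.CliqueFree (Δ + 1)) :
    BorelCombinatorics.borelChromaticNumber G ≤ (Δ : ℕ∞) := by
  have hdeg : ∀ v, (G.neighborSet v).encard ≤ Δ := fun v => by
    rw [← hΔ]
    exact le_iSup (fun v => (G.neighborSet v).encard) v
  obtain ⟨R, hR⟩ :=
    BorelCombinatorics.exists_extendable_closedBall hgrowth hΔ3 hdeg hclique
  obtain ⟨f, -, hf⟩ := hgrowth
  have : NeZero Δ := ⟨by lia⟩
  obtain ⟨c, hc⟩ := BorelCombinatorics.exists_isBorelColoring_of_isExtendable_closedBall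
    (hG.hasBorelNbhds hdeg) hdeg (fun v => hf v (2 * R + 1)) hR
  exact sInf_le ⟨Δ, rfl, c, hc⟩
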